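/- Let $n\ge 1$, let $\mu$ be Lebesgue measure on $\mathbb R^n$, and let $d_\mu(A,B)=\mu(A\Delta B)$. Let $\mathfrak L_n$ be the collection of Lebesgue measurable subsets of $\mathbb R^n$ of finite measure (sets at $d_\mu$-distance $0$ being regarded as equal). Write $\operatorname{ci}(A)$ for the closure of the interior of $A$, and let $\mathfrak J_n\subset\mathfrak L_n$ be the collection of bounded sets $A$ with $A=\operatorname{ci}(A)$ and $\mu(\partial A)=0$. **The measure average.** For nonempty $A$ let $d_S(p,A)=d(p,\partial A)$ if $p\in A$ and $d_S(p,A)=-d(p,\partial A)$ if $p\notin A$. For every nonempty $A\in\mathfrak J_n$ choose a center $q_A\in A$ with $d_S(q_A,A)=\sup_{a\in A}d_S(a,A)$, and fix real numbers $N\ge 1$ and $\varepsilon>0$. The constructions below are made for $t\in[0,1]$. 1. *Difference treated as a single component.* Let $A,B\in\mathfrak J_n$ with $B\subseteq A$. For $x\in\mathbb R$ put $f_x(p)=x\,d_S(p,A)+(1-x)\,d_S(p,B)$ if $B\ne\emptyset$, and $f_x(p)=x\,d_S(p,A)+(x-1)\|p-q_A\|$ if $B=\emptyset\neq A$. Let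 $D_x=\{p: f_x(p)\ge 0\}$ (with $D_x=\emptyset$ if $A=\emptyset$), $h(x)=\mu(D_x)$ and $\tau=t\mu(A)+(1-t)\mu(B)$. If $\mu(\{p:f_{1/2}(p)=0\})=0$ (or if $A=\emptyset$), set $S_t(A,B)=\operatorname{ci}(D_g)$, where $g$ is any minimizer of $|h(\xi)-\tau|$ over $\xi\in[-N,N]$. Otherwise set $S_t(A,B)=\operatorname{ci}(\{p:d(p,B)\le r\}\cap A)$, where $r\ge 0$ is any number with $\mu(\{p:d(p,B)\le r\}\cap A)=\tau$. 2. *Nested sets.* Let $A,B\in\mathfrak J_n$ with $B\subseteq A$. If $A=B$, set $M_t(A,A)=A$. Otherwise $M_t(A,B)=\bigcup_{P} S_t(P,B)$, where $P$ runs over the following finite family. If $A\setminus B$ has finitely many connected components, the $P$ are the sets $B\cup C$, $C$ a connected component of $A\setminus B$. If it has infinitely many, the $P$ are the sets $\operatorname{ci}(B\cup C)$, $C$ a component with $\mu(C)\ge\varepsilon$, together with $\operatorname{ci}(B\cup U)$, where $U$ is the union of all components of measure less than $\varepsilon$. 3. *General sets.* For $A,B\in\mathfrak J_n$, $$tA\oplus(1-t)B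 = M_t\bigl(A,\operatorname{ci}(A\cap B)\bigr)\cup M_{1-t}\bigl(B,\operatorname{ci}(A\cap B)\bigr).$$ **The subdivision scheme.** Let $m\ge 1$ and let $(F_i^0)_{i\in\mathbb Z}\subset\mathfrak J_n$ be such that $L:=\sup_{i\in\mathbb Z}d_\mu(F_i^0,F_{i+1}^0)<\infty$. For $k=0,1,2,\dots$ and $i\in\mathbb Z$ define $$F_{2i}^{k+1,0}=F_i^k,\qquad F_{2i+1}^{k+1,0}=\tfrac12F_i^k\oplus\tfrac12F_{i+1}^k,$$ $$F_i^{k+1,j}=\tfrac12F_i^{k+1,j-1}\oplus\tfrac12F_{i+1}^{k+1,j-1}\quad(1\le j\le m-1),\qquad F_i^{k+1}=F^{k+1,m-1}_{i-\lfloor (m-1)/2\rfloor},$$ and let $F_k(x)=\lambda F_i^k\oplus(1-\lambda)F_{i+1}^k$ with $\lambda=i+1-2^kx$, for $i2^{-k}\le x<(i+1)2^{-k}$. **Theorem.** For every such choice of centers, $N$, $\varepsilon$, $m$ and $(F_i^0)$, the functions $F_k$ take values in $\mathfrak J_n$, and there is a set-valued function $F^\infty:\mathbb R\to\mathfrak L_n$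 such that $F_k\to F^\infty$ uniformly on $\mathbb R$ with respect to $d_\mu$, and $F^\infty$ is Lipschitz continuous (in particular continuous) with Lipschitz constant $L$: $$d_\mu\bigl(F^\infty(x),F^\infty(y)\bigr)\le L\,|x-y|\qquad\text{for all }x,y\in\mathbb R .$$ -/

import Mathlib

open MeasureTheory Set

/-- The measure of the symmetric difference, with values in `[0, ∞]`. -/
noncomputable def dMu {n : ℕ} (A B : Set (EuclideanSpace ℝ (Fin n))) : ENNReal :=
  volume (symmDiff A B)

/-- Lebesgue measurable subsets of `ℝⁿ` of finite measure. -/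
def LSets (n : ℕ) : Set (Set (EuclideanSpace ℝ (Fin n))) :=
  {A | NullMeasurableSet A volume ∧ volume A ≠ ⊤}

/-- The closure of the interior. -/
def ci {n : ℕ} (A : Set (EuclideanSpace ℝ (Fin n))) : Set (EuclideanSpace ℝ (Fin n)) :=
  closure (interior A)

/-- Regular compact Jordan measurable subsets of `ℝⁿ`: bounded sets that coincide with the
closure of their interior and have a boundary of Lebesgue measure zero. -/
def JSets (n : ℕ) : Set (Set (EuclideanSpace ℝ (Fin n))) :=
  {A | Bornology.IsBounded A ∧ ci A = A ∧ volume (frontier A) = 0}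

open Classical in
/-- The signed distance from `p` to `A` (nonnegative inside). -/
noncomputable def sgnDist {n : ℕ} (p : EuclideanSpace ℝ (Fin n))
    (A : Set (EuclideanSpace ℝ (Fin n))) : ℝ :=
  if p ∈ A then Metric.infDist p (frontier A) else -Metric.infDist p (frontier A)

/-- `q` chooses, for each nonempty `A` in `JSets n`, a center of `A`: a point of `A` that
maximizes the signed distance to `A`. -/
def IsCenterSelection {n : ℕ}
    (q : Set (EuclideanSpace ℝ (Fin n)) → EuclideanSpace ℝ (Fin n)) : Prop :=
  ∀ A ∈ JSets n, A.Nonempty → q A ∈ A ∧ ∀ a ∈ A, sgnDist a A ≤ sgnDist (q A) A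

open Classical in
/-- The function whose nonnegativity set is the distance average of `A` and `B ⊆ A`. When `B` is
empty, the signed distance to `B` is replaced by minus the distance to the center of `A`. -/
noncomputable def levelFun {n : ℕ}
    (q : Set (EuclideanSpace ℝ (Fin n)) → EuclideanSpace ℝ (Fin n))
    (A B : Set (EuclideanSpace ℝ (Fin n))) (x : ℝ) (p : EuclideanSpace ℝ (Fin n)) : ℝ :=
  if B = ∅ then x * sgnDist p A + (x - 1) * ‖p - q A‖
  else x * sgnDist p A + (1 - x) * sgnDist p B

open Classical in
/-- The distance average of `A` and `B ⊆ A`, with parameter `x`. -/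
noncomputable def distAvg {n : ℕ}
    (q : Set (EuclideanSpace ℝ (Fin n)) → EuclideanSpace ℝ (Fin n))
    (x : ℝ) (A B : Set (EuclideanSpace ℝ (Fin n))) : Set (EuclideanSpace ℝ (Fin n)) :=
  if A = ∅ then ∅ else {p | 0 ≤ levelFun q A B x p}

/-- The zero-measure condition. -/
def ZeroMeasureCondition {n : ℕ}
    (q : Set (EuclideanSpace ℝ (Fin n)) → EuclideanSpace ℝ (Fin n))
    (A B : Set (EuclideanSpace ℝ (Fin n))) : Prop :=
  volume {p | levelFun q A B (1 / 2) p = 0} = 0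

/-- The number `t μ(A) + (1 - t) μ(B)`. -/
noncomputable def targetMeasure {n : ℕ} (t : ℝ) (A B : Set (EuclideanSpace ℝ (Fin n))) : ℝ :=
  t * volume.real A + (1 - t) * volume.real B

/-- The parameters in `[-N, N]` for which the measure of the distance average is as close as
possible to `t μ(A) + (1 - t) μ(B)`. -/
def reparamSet {n : ℕ}
    (q : Set (EuclideanSpace ℝ (Fin n)) → EuclideanSpace ℝ (Fin n)) (N t : ℝ)
    (A B : Set (EuclideanSpace ℝ (Fin n))) : Set ℝ :=
  {x | x ∈ Icc (-N) N ∧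
    IsMinOn (fun ξ => |volume.real (distAvg q ξ A B) - targetMeasure t A B|) (Icc (-N) N) x}

/-- The closed `r`-offset of `B`. -/
def offset {n : ℕ} (B : Set (EuclideanSpace ℝ (Fin n))) (r : ℝ) :
    Set (EuclideanSpace ℝ (Fin n)) :=
  {p | Metric.infDist p B ≤ r}

/-- The offset radii `r ≥ 0` for which `offset B r ∩ A` has measure `t μ(A) + (1 - t) μ(B)`. -/
def radiusSet {n : ℕ} (t : ℝ) (A B : Set (EuclideanSpace ℝ (Fin n))) : Set ℝ :=
  {r | 0 ≤ r ∧ volume.real (offset B r ∩ A) = targetMeasure t A B}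

open Classical in
/-- The measure average, for `t ∈ [0, 1]`, of `A` and `B ⊆ A` when `A \ B` is treated as a single
component. `Classical.epsilon` picks some element of the indicated set. -/
noncomputable def simpleAvg {n : ℕ}
    (q : Set (EuclideanSpace ℝ (Fin n)) → EuclideanSpace ℝ (Fin n)) (N t : ℝ)
    (A B : Set (EuclideanSpace ℝ (Fin n))) : Set (EuclideanSpace ℝ (Fin n)) :=
  if ZeroMeasureCondition q A B then
    ci (distAvg q (Classical.epsilon (fun x => x ∈ reparamSet q N t A B)) A B)
  else
    ci (offset B (Classical.epsilon (fun r => r ∈ radiusSet t A B)) ∩ A)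

/-- The connected components of a set. -/
def components {n : ℕ} (D : Set (EuclideanSpace ℝ (Fin n))) :
    Set (Set (EuclideanSpace ℝ (Fin n))) :=
  {C | ∃ x ∈ D, C = connectedComponentIn D x}

open Classical in
/-- The enlargements of `B` by the components of `A \ B` that are averaged with `B`. If there are
infinitely many components, all those of measure less than `ε` are joined into one set, and the
closure of the interior is taken to stay within the regular compact sets. -/
noncomputable def pieces {n : ℕ} (ε : ℝ) (A B : Set (EuclideanSpace ℝ (Fin n))) :
    Set (Set (EuclideanSpace ℝ (Fin n))) :=
  if (components (A \ B)).Finite then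
    {P | ∃ C ∈ components (A \ B), P = B ∪ C}
  else
    {P | ∃ C ∈ components (A \ B), ENNReal.ofReal ε ≤ volume C ∧ P = ci (B ∪ C)} ∪
      {ci (B ∪ ⋃₀ {C | C ∈ components (A \ B) ∧ volume C < ENNReal.ofReal ε})}

open Classical in
/-- The measure average `tA ⊕ (1 - t)B` of nested sets `B ⊆ A`, for `t ∈ [0, 1]`. -/
noncomputable def nestedAvg {n : ℕ}
    (q : Set (EuclideanSpace ℝ (Fin n)) → EuclideanSpace ℝ (Fin n)) (N ε t : ℝ)
    (A B : Set (EuclideanSpace ℝ (Fin n))) : Set (EuclideanSpace ℝ (Fin n)) :=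
  if A = B then A else ⋃ P ∈ pieces ε A B, simpleAvg q N t P B

/-- The measure average `tA ⊕ (1 - t)B` of `A` and `B`, for `t ∈ [0, 1]`. -/
noncomputable def measureAvg {n : ℕ}
    (q : Set (EuclideanSpace ℝ (Fin n)) → EuclideanSpace ℝ (Fin n)) (N ε t : ℝ)
    (A B : Set (EuclideanSpace ℝ (Fin n))) : Set (EuclideanSpace ℝ (Fin n)) :=
  nestedAvg q N ε t A (ci (A ∩ B)) ∪ nestedAvg q N ε (1 - t) B (ci (A ∩ B))

section Subdivision

/-- Doubling followed by one averaging step, for a binary average `avg t A B` standing for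
`tA ⊕ (1 - t)B`. -/
noncomputable def doubleStep {α : Type*} (avg : ℝ → α → α → α) (F : ℤ → α) : ℤ → α :=
  fun i => if Even i then F (i / 2) else avg (1 / 2) (F (i / 2)) (F (i / 2 + 1))

/-- Averaging of consecutive elements. -/
noncomputable def averageStep {α : Type*} (avg : ℝ → α → α → α) (F : ℤ → α) : ℤ → α :=
  fun i => avg (1 / 2) (F i) (F (i + 1))

/-- One step of the Lane-Riesenfeld algorithm of degree `m ≥ 1`. -/
noncomputable def refine {α : Type*} (avg : ℝ → α → α → α) (m : ℕ) (F : ℤ → α) : ℤ → α :=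
  fun i => (averageStep avg)^[m - 1] (doubleStep avg F) (i - ((m - 1) / 2 : ℕ))

/-- The data at level `k`. -/
noncomputable def level {α : Type*} (avg : ℝ → α → α → α) (m : ℕ) (F : ℤ → α) (k : ℕ) : ℤ → α :=
  (refine avg m)^[k] F

/-- The piecewise interpolant at level `k`: on `[i 2⁻ᵏ, (i + 1) 2⁻ᵏ)` it is the average of the
`i`-th and `(i + 1)`-st elements with weights `λ = i + 1 - 2ᵏ x` and `1 - λ`. -/
noncomputable def interpolant {α : Type*} (avg : ℝ → α → α → α) (m : ℕ) (F : ℤ → α) (k : ℕ)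
    (x : ℝ) : α :=
  avg ((⌊x * 2 ^ k⌋ : ℝ) + 1 - x * 2 ^ k)
    (level avg m F k ⌊x * 2 ^ k⌋) (level avg m F k (⌊x * 2 ^ k⌋ + 1))

end Subdivision

/-! ### Porous sets, null level sets and the Lebesgue density theorem -/

section Porosity

open Metric Filter Topology

/-! Everything rests on one property of the measure average: `tA ⊕ (1-t)B` lies within
`(1-t)·d(A,B)` of `A` and within `t·d(A,B)` of `B`. In any pseudometric space a binary average with
this property makes the scheme contract. Doubling halves the bound on the gaps between neighbours,
averaging does not enlarge it, and one refinement moves elements by at most a constant depending on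
`m` times the old bound. Hence the gaps at level `k` are at most `L·2⁻ᵏ`, and consecutive
interpolants differ by `O(2⁻ᵏ)` uniformly in `x`. The set of points lying in infinitely many
`F_k(x)` is the limit; counting the cells between `x` and `y` gives `L|x-y| + O(2⁻ᵏ)` at level `k`.

The property itself follows from an exact measure statement, `IsNestedAverage`: for `B ⊆ A` the
average is a regular set between `B` and `A` whose measure is precisely the target. For a single
component this needs continuity of the measure of the distance average in its parameter on `[0,1]`,
that is, null zero sets of the level functions. These functions are 1-Lipschitz, and a level set of
such a function is null if near each of its points the function leaves its value at a linear rate: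
the set is then porous and has no density points. For a parameter `x` in `(0,1)` other than `1/2`,
the more heavily weighted distance supplies the rate `|1-2x|`. The case `1/2` is the zero-measure
condition, which is automatic for `B = ∅`. The intermediate value theorem on `[0,1] ⊆ [-N,N]` then
shows that the minimum of the measure error is zero. The offset construction is handled by the same
porosity argument.

Several components cause no loss: adjoining components of `A \ B` to `B` creates no boundary outside
`∂A ∪ ∂B`, so all pieces are Jordan measurable and their measures add up. -/

/-- A measurable set that is porous at each of its points has measure zero. -/
theorem measure_eq_zero_of_porous {E : Type*} [NormedAddCommGroup E] [NormedSpace ℝ E]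
    [FiniteDimensional ℝ E] [Nontrivial E] [MeasurableSpace E] [BorelSpace E] (μ : Measure E)
    [μ.IsAddHaarMeasure] {S : Set E} (hS : MeasurableSet S)
    (h : ∀ p ∈ S, ∃ κ > 0, ∃ δ > 0, ∀ s ∈ Ioo (0 : ℝ) δ,
      ∃ y, dist y p ≤ s ∧ Disjoint (ball y (κ * s)) S) : μ S = 0 := by
  have hd := Besicovitch.ae_tendsto_measure_inter_div μ S
  rw [ae_restrict_iff' hS] at hd
  refine measure_mono_null ?_ (ae_iff.1 hd)
  intro p hp hcon
  have ht := hcon hp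
  obtain ⟨κ, hκ, δ, hδ, H⟩ := h p hp
  -- With `s = r/(1+κ)` the hole has radius `κs = θr`, and `s + κs = r` puts it inside the ball of
  -- radius `r` about `p`. The density ratio therefore stays below `1 - θ^d` and cannot tend to 1.
  set θ : ℝ := κ / (1 + κ) with hθ
  have h1κ : 0 < 1 + κ := by linarith
  have hθ0 : 0 < θ := by positivity
  have hθd : 0 < θ ^ Module.finrank ℝ E := by positivity
  have key : ∀ᶠ r in 𝓝[>] (0 : ℝ), μ (S ∩ closedBall p r) / μ (closedBall p r) ≤
      1 - ENNReal.ofReal (θ ^ Module.finrank ℝ E) := by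
    have hmem : Ioo 0 ((1 + κ) * δ) ∈ 𝓝[>] (0 : ℝ) := Ioo_mem_nhdsGT (by positivity)
    filter_upwards [hmem] with r hr
    obtain ⟨y, hy, hyS⟩ := H (r / (1 + κ)) ⟨div_pos hr.1 h1κ, by
      rw [div_lt_iff₀ h1κ]; linarith [hr.2]⟩
    have hrad : κ * (r / (1 + κ)) = θ * r := by rw [hθ]; ring
    rw [hrad] at hyS
    have hsub : ball y (θ * r) ⊆ closedBall p r := by
      intro z hz
      rw [mem_ball] at hz
      rw [mem_closedBall]
      have := dist_triangle z y p
      have h2 : r / (1 + κ) + θ * r = r := by rw [hθ]; field_simp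
      linarith
    have hle : S ∩ closedBall p r ⊆ closedBall p r \ ball y (θ * r) := fun z hz =>
      ⟨hz.2, fun hzb => disjoint_left.1 hyS hzb hz.1⟩
    have hfin : μ (closedBall p r) ≠ ⊤ := measure_closedBall_lt_top.ne
    have hpos : μ (closedBall p r) ≠ 0 := (measure_closedBall_pos μ p hr.1).ne'
    have hball : μ (ball y (θ * r)) =
        ENNReal.ofReal (θ ^ Module.finrank ℝ E) * μ (closedBall p r) := by
      rw [Measure.addHaar_ball_mul μ y hθ0.le, Measure.addHaar_closedBall_eq_addHaar_ball,
        Measure.addHaar_ball_center μ p]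
    refine ENNReal.div_le_of_le_mul ?_
    refine (measure_mono hle).trans ?_
    rw [measure_sdiff hsub measurableSet_ball.nullMeasurableSet measure_ball_lt_top.ne, hball,
      ENNReal.sub_mul (fun _ _ => hfin), one_mul]
  have h1 := le_of_tendsto ht key
  have h2 : (1 : ENNReal) - ENNReal.ofReal (θ ^ Module.finrank ℝ E) < 1 :=
    ENNReal.sub_lt_self ENNReal.one_ne_top one_ne_zero (by simpa using hθd)
  exact absurd h1 (not_le.2 h2)

/-- A level set of a `1`-Lipschitz function is null when, near each of its points, the function
departs from its value at a linear rate in some direction. -/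
theorem measure_level_eq_zero {E : Type*} [NormedAddCommGroup E] [NormedSpace ℝ E]
    [FiniteDimensional ℝ E] [Nontrivial E] [MeasurableSpace E] [BorelSpace E] (μ : Measure E)
    [μ.IsAddHaarMeasure] {f : E → ℝ} (hf : LipschitzWith 1 f) {c : ℝ} {S : Set E}
    (hS : MeasurableSet S) (hSc : ∀ p ∈ S, f p = c)
    (h : ∀ p ∈ S, ∃ κ > 0, ∃ δ > 0, ∀ s ∈ Ioo (0 : ℝ) δ,
      ∃ y, dist y p ≤ s ∧ κ * s ≤ |f y - c|) : μ S = 0 := by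
  refine measure_eq_zero_of_porous μ hS fun p hp => ?_
  obtain ⟨κ, hκ, δ, hδ, H⟩ := h p hp
  refine ⟨κ, hκ, δ, hδ, fun s hs => ?_⟩
  obtain ⟨y, hy, hfy⟩ := H s hs
  -- Since `f` is 1-Lipschitz and differs from `c` by at least `κs` at `y`, it cannot take the value
  -- `c` in the open ball of radius `κs`.
  refine ⟨y, hy, disjoint_left.2 fun z hz hzS => ?_⟩
  have h1 := hf.dist_le_mul y z
  rw [hSc z hzS, Real.dist_eq, NNReal.coe_one, one_mul, dist_comm] at h1
  rw [mem_ball] at hz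
  linarith

/-- Moving towards a nearest point of a closed set decreases the distance at unit rate. -/
theorem exists_infDist_decreasing_direction {E : Type*} [NormedAddCommGroup E] [NormedSpace ℝ E]
    [ProperSpace E] {K : Set E} (hK : IsClosed K) (hne : K.Nonempty) {p : E} (hp : p ∉ K) :
    ∃ v : E, ‖v‖ = 1 ∧ 0 < infDist p K ∧ p + infDist p K • v ∈ K ∧
      ∀ s ∈ Icc 0 (infDist p K), infDist (p + s • v) K ≤ infDist p K - s := by
  obtain ⟨y, hyK, hy⟩ := hK.exists_infDist_eq_dist hne p
  have hpos : 0 < infDist p K := (hK.notMem_iff_infDist_pos hne).1 hp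
  set d := infDist p K
  have hny : ‖y - p‖ = d := by rw [hy, dist_comm, dist_eq_norm]
  have hend : p + d • (d⁻¹ • (y - p)) = y := by
    rw [smul_smul, mul_inv_cancel₀ hpos.ne', one_smul]; abel
  have hv : ‖d⁻¹ • (y - p)‖ = 1 := by
    rw [norm_smul, hny, norm_inv, Real.norm_of_nonneg hpos.le, inv_mul_cancel₀ hpos.ne']
  refine ⟨d⁻¹ • (y - p), hv, hpos, by rwa [hend], fun s hs => ?_⟩
  refine (infDist_le_dist_of_mem hyK).trans (le_of_eq ?_)
  nth_rw 2 [← hend]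
  rw [dist_eq_norm, add_sub_add_left_eq_sub, ← sub_smul, norm_smul, hv, mul_one, norm_sub_rev,
    Real.norm_of_nonneg (by linarith [hs.2])]

/-- A segment from a point of a set to a point outside meets the frontier. -/
theorem exists_mem_frontier_dist_add_dist {E : Type*} [NormedAddCommGroup E] [NormedSpace ℝ E]
    {A : Set E} {p y : E} (hp : p ∈ A) (hy : y ∉ A) :
    ∃ z ∈ frontier A, dist p z + dist z y = dist p y := by
  by_contra! hcon
  have hdis : ∀ z ∈ segment ℝ p y, z ∉ frontier A := fun z hz hzA =>
    hcon z hzA (dist_add_dist_of_mem_segment hz)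
  have hsub : segment ℝ p y ⊆ interior A ∪ (closure A)ᶜ := by
    intro z hz
    by_cases hzc : z ∈ closure A
    · left
      by_contra hzi
      exact hdis z hz ⟨hzc, hzi⟩
    · exact Or.inr hzc
  have hpi : p ∈ interior A := (hsub (left_mem_segment ℝ p y)).resolve_right
    (fun h => h (subset_closure hp))
  have := (convex_segment p y).isPreconnected.subset_left_of_subset_union isOpen_interior
    isClosed_closure.isOpen_compl
    (disjoint_compl_right.mono_left (interior_subset.trans subset_closure)) hsub
    ⟨p, left_mem_segment ℝ p y, hpi⟩
  exact hy (interior_subset (this (right_mem_segment ℝ p y)))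

end Porosity

/-! ### Regular closed sets with null boundary -/

section RegularSets

variable {n : ℕ} {A B D : Set (EuclideanSpace ℝ (Fin n))}

theorem isClosed_of_mem_JSets (hA : A ∈ JSets n) : IsClosed A := by
  rw [← hA.2.1]; exact isClosed_closure

theorem measurableSet_of_mem_JSets (hA : A ∈ JSets n) : MeasurableSet A :=
  (isClosed_of_mem_JSets hA).measurableSet

theorem volume_ne_top_of_mem_JSets (hA : A ∈ JSets n) : volume A ≠ ⊤ :=
  hA.1.measure_lt_top.ne

theorem interior_nonempty_of_mem_JSets (hA : A ∈ JSets n) (hne : A.Nonempty) :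
    (interior A).Nonempty := by
  rw [← hA.2.1] at hne
  exact closure_nonempty_iff.1 hne

theorem frontier_nonempty_of_mem_JSets [Nontrivial (EuclideanSpace ℝ (Fin n))]
    (hA : A ∈ JSets n) (hne : A.Nonempty) : (frontier A).Nonempty := by
  refine nonempty_frontier_iff.2 ⟨hne, ?_⟩
  rintro rfl
  exact NormedSpace.unbounded_univ ℝ (EuclideanSpace ℝ (Fin n)) hA.1

theorem empty_mem_JSets : (∅ : Set (EuclideanSpace ℝ (Fin n))) ∈ JSets n := by
  simp [JSets, ci]

theorem ci_idem (D : Set (EuclideanSpace ℝ (Fin n))) : ci (ci D) = ci D :=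
  closure_interior_idem

theorem ci_mono (h : A ⊆ B) : ci A ⊆ ci B := closure_mono (interior_mono h)

theorem ci_subset_closure (D : Set (EuclideanSpace ℝ (Fin n))) : ci D ⊆ closure D :=
  closure_mono interior_subset

theorem interior_subset_interior_ci (D : Set (EuclideanSpace ℝ (Fin n))) :
    interior D ⊆ interior (ci D) := interior_maximal subset_closure isOpen_interior

theorem ci_mem_JSets (hb : Bornology.IsBounded D) (h0 : volume (frontier D) = 0) :
    ci D ∈ JSets n := by
  refine ⟨hb.closure.subset (ci_subset_closure D), ci_idem D, measure_mono_null ?_ h0⟩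
  have hc : IsClosed (ci D) := isClosed_closure
  rw [hc.frontier_eq]
  exact sdiff_subset_sdiff (ci_subset_closure D) (interior_subset_interior_ci D)

theorem ci_ae_eq (h0 : volume (frontier D) = 0) : ci D =ᵐ[volume] D := by
  have h1 : interior D =ᵐ[volume] D := interior_ae_eq_of_null_frontier h0
  have h2 : closure D =ᵐ[volume] D := closure_ae_eq_of_null_frontier h0
  have h3 : interior D ≤ᵐ[volume] ci D := Filter.Eventually.of_forall subset_closure
  have h4 : ci D ≤ᵐ[volume] closure D := Filter.Eventually.of_forall (ci_subset_closure D)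
  exact (h4.trans h2.le).antisymm (h1.symm.le.trans h3)

/-- An open null set is empty, so an almost-everywhere inclusion into a closed set is a true
inclusion on the interior. For regular sets this removes all null-set ambiguity. -/
theorem interior_subset_of_ae_le (hD : IsClosed D) (h : A ≤ᵐ[volume] D) : interior A ⊆ D := by
  have h0 : volume (interior A \ D) = 0 :=
    measure_mono_null (sdiff_subset_sdiff_left interior_subset) (ae_le_set.1 h)
  have := (isOpen_interior.sdiff hD).measure_eq_zero_iff volume |>.1 h0
  exact sdiff_eq_empty.1 this

theorem subset_of_ae_le (hA : A ∈ JSets n) (hD : IsClosed D) (h : A ≤ᵐ[volume] D) : A ⊆ D := by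
  rw [← hA.2.1]
  exact closure_minimal (interior_subset_of_ae_le hD h) hD

theorem ci_eq_of_ae_eq (hA : A ∈ JSets n) (hD : IsClosed D) (h : D =ᵐ[volume] A) : ci D = A := by
  have h1 : interior D ⊆ interior A := interior_maximal
    (interior_subset_of_ae_le (isClosed_of_mem_JSets hA) h.le) isOpen_interior
  have h2 : interior A ⊆ interior D := interior_maximal
    (interior_subset_of_ae_le hD h.symm.le) isOpen_interior
  rw [ci, h1.antisymm h2]
  exact hA.2.1

theorem union_mem_JSets (hA : A ∈ JSets n) (hB : B ∈ JSets n) : A ∪ B ∈ JSets n := by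
  refine ⟨hA.1.union hB.1, ?_, ?_⟩
  · apply Subset.antisymm
    · exact (ci_subset_closure _).trans
        ((isClosed_of_mem_JSets hA).union (isClosed_of_mem_JSets hB)).closure_eq.subset
    · refine union_subset ?_ ?_
      · exact hA.2.1.symm.subset.trans (ci_mono subset_union_left)
      · exact hB.2.1.symm.subset.trans (ci_mono subset_union_right)
  · refine measure_mono_null ((frontier_union_subset A B).trans
      (union_subset_union inter_subset_left inter_subset_right)) ?_
    exact measure_union_null hA.2.2 hB.2.2

theorem volume_frontier_inter_eq_zero (hA : volume (frontier A) = 0)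
    (hB : volume (frontier B) = 0) : volume (frontier (A ∩ B)) = 0 :=
  measure_mono_null ((frontier_inter_subset A B).trans
      (union_subset_union inter_subset_left inter_subset_right)) (measure_union_null hA hB)

theorem biUnion_mem_JSets {ι : Type*} {s : Set ι} (hs : s.Finite)
    {f : ι → Set (EuclideanSpace ℝ (Fin n))} (hf : ∀ i ∈ s, f i ∈ JSets n) :
    ⋃ i ∈ s, f i ∈ JSets n := by
  induction s, hs using Set.Finite.induction_on with
  | empty => simpa using empty_mem_JSets
  | insert _ _ ih =>
    rw [biUnion_insert]
    exact union_mem_JSets (hf _ (mem_insert _ _)) (ih fun i hi => hf i (mem_insert_of_mem _ hi))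

end RegularSets

/-! ### Lipschitz, monotonicity and unit-rate properties of the signed distance -/

section SignedDistance

open Metric

variable {n : ℕ} {A B : Set (EuclideanSpace ℝ (Fin n))} {p y : EuclideanSpace ℝ (Fin n)}

theorem sgnDist_of_mem (h : p ∈ A) : sgnDist p A = infDist p (frontier A) := if_pos h

theorem sgnDist_of_notMem (h : p ∉ A) : sgnDist p A = -infDist p (frontier A) := if_neg h

/-- The segment from `p` to `y` crosses the frontier, and the crossing point splits its length. This
handles sign changes in both the Lipschitz bound and the monotonicity in the set. -/
theorem infDist_add_infDist_le_dist (hp : p ∈ A) (hy : y ∉ A) :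
    infDist p (frontier A) + infDist y (frontier A) ≤ dist p y := by
  obtain ⟨z, hz, h⟩ := exists_mem_frontier_dist_add_dist hp hy
  have h1 := infDist_le_dist_of_mem (x := p) hz
  have h2 := infDist_le_dist_of_mem (x := y) hz
  rw [dist_comm y z] at h2
  linarith

theorem lipschitzWith_sgnDist (A : Set (EuclideanSpace ℝ (Fin n))) :
    LipschitzWith 1 (fun p => sgnDist p A) := by
  refine LipschitzWith.of_le_add fun p y => ?_
  have h1 := infDist_le_infDist_add_dist (s := frontier A) (x := p) (y := y)
  have h2 := infDist_le_infDist_add_dist (s := frontier A) (x := y) (y := p)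
  have h3 := infDist_nonneg (s := frontier A) (x := p)
  have h4 := infDist_nonneg (s := frontier A) (x := y)
  have h5 := dist_nonneg (x := p) (y := y)
  rw [dist_comm y p] at h2
  by_cases hp : p ∈ A <;> by_cases hy : y ∈ A
  · rw [sgnDist_of_mem hp, sgnDist_of_mem hy]; linarith
  · have := infDist_add_infDist_le_dist hp hy
    rw [sgnDist_of_mem hp, sgnDist_of_notMem hy]; linarith
  · rw [sgnDist_of_notMem hp, sgnDist_of_mem hy]; linarith
  · rw [sgnDist_of_notMem hp, sgnDist_of_notMem hy]; linarith

variable [Nontrivial (EuclideanSpace ℝ (Fin n))]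

theorem infDist_frontier_pos (hA : A ∈ JSets n) (hne : A.Nonempty) (hp : p ∉ frontier A) :
    0 < infDist p (frontier A) :=
  (isClosed_frontier.notMem_iff_infDist_pos (frontier_nonempty_of_mem_JSets hA hne)).1 hp

theorem sgnDist_nonneg_iff (hA : A ∈ JSets n) (hne : A.Nonempty) : 0 ≤ sgnDist p A ↔ p ∈ A := by
  refine ⟨fun h => ?_, fun h => by rw [sgnDist_of_mem h]; exact infDist_nonneg⟩
  by_contra hp
  have : 0 < infDist p (frontier A) := infDist_frontier_pos hA hne
    fun hf => hp ((isClosed_of_mem_JSets hA).frontier_subset hf)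
  rw [sgnDist_of_notMem hp] at h
  linarith

theorem sgnDist_eq_zero_iff (hA : A ∈ JSets n) (hne : A.Nonempty) :
    sgnDist p A = 0 ↔ p ∈ frontier A := by
  constructor
  · intro h
    by_contra hp
    have := infDist_frontier_pos hA hne hp
    by_cases hpA : p ∈ A
    · rw [sgnDist_of_mem hpA] at h; linarith
    · rw [sgnDist_of_notMem hpA] at h; linarith
  · intro h
    rw [sgnDist_of_mem ((isClosed_of_mem_JSets hA).frontier_subset h), infDist_zero_of_mem h]

theorem sgnDist_mono (hA : A ∈ JSets n) (hB : B ∈ JSets n) (hBA : B ⊆ A) (hne : B.Nonempty) :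
    sgnDist p B ≤ sgnDist p A := by
  by_cases hpA : p ∈ A
  · by_cases hpB : p ∈ B
    · rw [sgnDist_of_mem hpA, sgnDist_of_mem hpB]
      refine (le_infDist (frontier_nonempty_of_mem_JSets hA (hne.mono hBA))).2 fun y hy => ?_
      by_cases hyB : y ∈ B
      · exact infDist_le_dist_of_mem ⟨subset_closure hyB, fun h => hy.2 (interior_mono hBA h)⟩
      · have := infDist_add_infDist_le_dist hpB hyB
        linarith [infDist_nonneg (x := y) (s := frontier B)]
    · exact (not_le.1 (mt (sgnDist_nonneg_iff hB hne).1 hpB)).le.trans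
        ((sgnDist_nonneg_iff hA (hne.mono hBA)).2 hpA)
  · rw [sgnDist_of_notMem hpA, sgnDist_of_notMem (fun h => hpA (hBA h)), neg_le_neg_iff]
    refine (le_infDist (frontier_nonempty_of_mem_JSets hB hne)).2 fun y hy => ?_
    have := infDist_add_infDist_le_dist (hBA ((isClosed_of_mem_JSets hB).frontier_subset hy)) hpA
    rw [dist_comm] at this
    linarith [infDist_nonneg (x := y) (s := frontier A)]

/-- Inside `A`, the signed distance decreases at unit rate in some direction. -/
theorem exists_sgnDist_decreasing_direction (hA : A ∈ JSets n) (hp : 0 < sgnDist p A) :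
    ∃ v : EuclideanSpace ℝ (Fin n), ‖v‖ = 1 ∧ p + sgnDist p A • v ∈ frontier A ∧
      ∀ s ∈ Icc 0 (sgnDist p A), sgnDist (p + s • v) A ≤ sgnDist p A - s := by
  have hpA : p ∈ A := by
    by_contra h
    rw [sgnDist_of_notMem h] at hp
    linarith [infDist_nonneg (x := p) (s := frontier A)]
  have hpf : p ∉ frontier A := fun h => hp.ne' ((sgnDist_eq_zero_iff hA ⟨p, hpA⟩).2 h)
  obtain ⟨v, hv, -, hend, H⟩ := exists_infDist_decreasing_direction isClosed_frontier
    (frontier_nonempty_of_mem_JSets hA ⟨p, hpA⟩) hpf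
  rw [sgnDist_of_mem hpA]
  refine ⟨v, hv, hend, fun s hs => le_trans ?_ (H s hs)⟩
  by_cases h : p + s • v ∈ A
  · rw [sgnDist_of_mem h]
  · rw [sgnDist_of_notMem h]
    linarith [infDist_nonneg (x := p + s • v) (s := frontier A)]

/-- Outside `B`, the signed distance increases at unit rate in some direction. -/
theorem exists_sgnDist_increasing_direction (hB : B ∈ JSets n) (hne : B.Nonempty)
    (hp : sgnDist p B < 0) :
    ∃ v : EuclideanSpace ℝ (Fin n), ‖v‖ = 1 ∧
      ∀ s ∈ Icc 0 (-sgnDist p B), sgnDist p B + s ≤ sgnDist (p + s • v) B := by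
  have hpB : p ∉ B := fun h => not_le.2 hp ((sgnDist_nonneg_iff hB hne).2 h)
  obtain ⟨v, hv, -, hend, H⟩ := exists_infDist_decreasing_direction isClosed_frontier
    (frontier_nonempty_of_mem_JSets hB hne)
    fun h => hpB ((isClosed_of_mem_JSets hB).frontier_subset h)
  rw [sgnDist_of_notMem hpB, neg_neg]
  refine ⟨v, hv, fun s hs => ?_⟩
  have h1 := H s hs
  by_cases h : p + s • v ∈ B
  · rw [sgnDist_of_mem h]
    linarith [infDist_nonneg (x := p + s • v) (s := frontier B), hs.2]
  · rw [sgnDist_of_notMem h]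
    linarith

end SignedDistance

/-! ### Level functions and their null zero sets -/

section LevelFunction

open Metric

open Classical in
/-- The function that the level function assigns to the parameter `0`. -/
noncomputable def lowerFun {n : ℕ} (q : Set (EuclideanSpace ℝ (Fin n)) → EuclideanSpace ℝ (Fin n))
    (A B : Set (EuclideanSpace ℝ (Fin n))) (p : EuclideanSpace ℝ (Fin n)) : ℝ :=
  if B = ∅ then -‖p - q A‖ else sgnDist p B

variable {n : ℕ} {q : Set (EuclideanSpace ℝ (Fin n)) → EuclideanSpace ℝ (Fin n)}
  {A B : Set (EuclideanSpace ℝ (Fin n))} {p : EuclideanSpace ℝ (Fin n)} {x : ℝ}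

theorem lowerFun_empty (p : EuclideanSpace ℝ (Fin n)) : lowerFun q A ∅ p = -‖p - q A‖ := if_pos rfl

theorem lowerFun_of_nonempty (hB : B.Nonempty) (p : EuclideanSpace ℝ (Fin n)) :
    lowerFun q A B p = sgnDist p B := if_neg hB.ne_empty

/-- One formula, affine in `x`, covers empty and nonempty `B`, so most later arguments need no case
distinction. -/
theorem levelFun_eq (x : ℝ) (p : EuclideanSpace ℝ (Fin n)) :
    levelFun q A B x p = x * sgnDist p A + (1 - x) * lowerFun q A B p := by
  unfold levelFun lowerFun
  split_ifs <;> ring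

theorem lipschitzWith_lowerFun : LipschitzWith 1 (lowerFun q A B) := by
  rcases B.eq_empty_or_nonempty with rfl | hB
  · refine LipschitzWith.of_le_add fun p y => ?_
    rw [lowerFun_empty, lowerFun_empty, ← dist_eq_norm, ← dist_eq_norm]
    linarith [dist_triangle_left y (q A) p]
  · rw [show lowerFun q A B = fun p => sgnDist p B from funext (lowerFun_of_nonempty hB)]
    exact lipschitzWith_sgnDist B

theorem continuous_levelFun (x : ℝ) : Continuous (levelFun q A B x) := by
  have h : levelFun q A B x = fun p => x * sgnDist p A + (1 - x) * lowerFun q A B p :=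
    funext (levelFun_eq x)
  rw [h]
  exact (continuous_const.mul (lipschitzWith_sgnDist A).continuous).add
    (continuous_const.mul lipschitzWith_lowerFun.continuous)

theorem lipschitzWith_levelFun (hx : x ∈ Icc (0 : ℝ) 1) : LipschitzWith 1 (levelFun q A B x) := by
  refine LipschitzWith.of_le_add fun p y => ?_
  rw [levelFun_eq, levelFun_eq]
  have h1 := (lipschitzWith_sgnDist A).le_add_mul p y
  have h2 := (lipschitzWith_lowerFun (q := q) (A := A) (B := B)).le_add_mul p y
  rw [NNReal.coe_one, one_mul] at h1 h2
  have h3 := mul_le_mul_of_nonneg_left h1 hx.1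
  have h4 := mul_le_mul_of_nonneg_left h2 (sub_nonneg.2 hx.2)
  linarith

theorem isClosed_distAvg (x : ℝ) : IsClosed (distAvg q x A B) := by
  unfold distAvg
  split_ifs
  · exact isClosed_empty
  · exact isClosed_le continuous_const (continuous_levelFun x)

theorem mem_distAvg (hne : A.Nonempty) : p ∈ distAvg q x A B ↔ 0 ≤ levelFun q A B x p := by
  rw [distAvg, if_neg hne.ne_empty, mem_ofPred_eq]

theorem measurableSet_levelFun_eq_zero_inter :
    MeasurableSet {p | levelFun q A B x p = 0 ∧ 0 < sgnDist p A} :=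
  (isClosed_eq (continuous_levelFun x) continuous_const).measurableSet.inter
    (isOpen_lt continuous_const (lipschitzWith_sgnDist A).continuous).measurableSet

variable [Nontrivial (EuclideanSpace ℝ (Fin n))]

/-- This makes the level function nondecreasing in its parameter. For `B = ∅` it holds because the
signed distance is 1-Lipschitz and nonnegative at the center. -/
theorem lowerFun_le_sgnDist (hq : IsCenterSelection q) (hA : A ∈ JSets n) (hB : B ∈ JSets n)
    (hBA : B ⊆ A) (hne : A.Nonempty) (p : EuclideanSpace ℝ (Fin n)) :
    lowerFun q A B p ≤ sgnDist p A := by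
  rcases B.eq_empty_or_nonempty with rfl | hB'
  · rw [lowerFun_empty, ← dist_eq_norm]
    have h1 := (lipschitzWith_sgnDist A).le_add_mul (q A) p
    have h2 := (sgnDist_nonneg_iff hA hne).2 (hq A hA hne).1
    rw [NNReal.coe_one, one_mul, dist_comm] at h1
    linarith
  · rw [lowerFun_of_nonempty hB']
    exact sgnDist_mono hA hB hBA hB'

theorem volume_lowerFun_eq_zero (hB : B ∈ JSets n) : volume {p | lowerFun q A B p = 0} = 0 := by
  rcases B.eq_empty_or_nonempty with rfl | hB'
  · have : {p | lowerFun q A ∅ p = 0} = {q A} := by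
      ext p
      simp [lowerFun_empty, sub_eq_zero]
    rw [this, measure_singleton]
  · have : {p | lowerFun q A B p = 0} = frontier B := by
      ext p
      rw [mem_ofPred_eq, lowerFun_of_nonempty hB', sgnDist_eq_zero_iff hB hB']
    rw [this, hB.2.2]

/-- Only almost everywhere: for `B = ∅` the distance average with parameter 0 is the single point `q
A`. -/
theorem distAvg_zero_ae_eq (hB : B ∈ JSets n) (hne : A.Nonempty) :
    distAvg q 0 A B =ᵐ[volume] B := by
  rcases B.eq_empty_or_nonempty with rfl | hB'
  · refine ae_eq_empty.2 (measure_mono_null (fun p hp => ?_) (measure_singleton (q A)))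
    rw [mem_distAvg hne, levelFun_eq, lowerFun_empty] at hp
    have : ‖p - q A‖ = 0 := le_antisymm (by linarith) (norm_nonneg _)
    exact sub_eq_zero.1 (norm_eq_zero.1 this)
  · refine Filter.EventuallyEq.of_eq (Set.ext fun p => ?_)
    rw [mem_distAvg hne, levelFun_eq, lowerFun_of_nonempty hB', ← sgnDist_nonneg_iff hB hB']
    simp

theorem distAvg_one (hA : A ∈ JSets n) (hne : A.Nonempty) : distAvg q 1 A B = A := by
  ext p
  rw [mem_distAvg hne, levelFun_eq, ← sgnDist_nonneg_iff hA hne]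
  simp

theorem distAvg_mono (hq : IsCenterSelection q) (hA : A ∈ JSets n) (hB : B ∈ JSets n)
    (hBA : B ⊆ A) (hne : A.Nonempty) {x y : ℝ} (hxy : x ≤ y) :
    distAvg q x A B ⊆ distAvg q y A B := by
  intro p hp
  rw [mem_distAvg hne, levelFun_eq] at hp ⊢
  have h1 := lowerFun_le_sgnDist hq hA hB hBA hne p
  nlinarith [mul_nonneg (sub_nonneg.2 hxy) (sub_nonneg.2 h1)]

/-- Parameters above 1 occur because the minimizer ranges over `[-N, N]`. Far from `A` the term with
weight `x` decreases like `x‖p‖`, while the other grows at most like `(x-1)‖p‖`; the surplus `‖p‖`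
gives the radius. -/
theorem isBounded_distAvg (hq : IsCenterSelection q) (hA : A ∈ JSets n) (hB : B ∈ JSets n)
    (hBA : B ⊆ A) (hne : A.Nonempty) (x : ℝ) : Bornology.IsBounded (distAvg q x A B) := by
  rcases le_total x 1 with hx | hx
  · exact hA.1.subset ((distAvg_mono hq hA hB hBA hne hx).trans (distAvg_one hA hne).subset)
  obtain ⟨R, hR⟩ := hA.1.subset_closedBall 0
  refine (hA.1.union (isBounded_closedBall (x := (0 : EuclideanSpace ℝ (Fin n)))
    (r := x * R - (x - 1) * lowerFun q A B 0))).subset fun p hp => ?_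
  by_cases hpA : p ∈ A
  · exact Or.inl hpA
  right
  rw [mem_distAvg hne, levelFun_eq, sgnDist_of_notMem hpA] at hp
  have h1 : ‖p‖ - R ≤ infDist p (frontier A) := by
    refine (le_infDist (frontier_nonempty_of_mem_JSets hA hne)).2 fun y hy => ?_
    have hy' := hR ((isClosed_of_mem_JSets hA).frontier_subset hy)
    rw [mem_closedBall_zero_iff] at hy'
    rw [dist_eq_norm]
    linarith [norm_sub_norm_le p y]
  have h2 := (lipschitzWith_lowerFun (q := q) (A := A) (B := B)).le_add_mul 0 p
  rw [NNReal.coe_one, one_mul, dist_zero_left] at h2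
  rw [mem_closedBall_zero_iff]
  have h3 := mul_le_mul_of_nonneg_left h1 (zero_le_one.trans hx)
  have h4 := mul_le_mul_of_nonneg_left h2 (sub_nonneg.2 hx)
  linarith

theorem exists_lowerFun_increasing_direction (hB : B ∈ JSets n) (hp : lowerFun q A B p < 0) :
    ∃ v : EuclideanSpace ℝ (Fin n), ‖v‖ = 1 ∧
      ∀ s ∈ Icc 0 (-lowerFun q A B p), lowerFun q A B p + s ≤ lowerFun q A B (p + s • v) := by
  rcases B.eq_empty_or_nonempty with rfl | hB'
  · rw [lowerFun_empty] at hp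
    have hpq : p ∉ ({q A} : Set (EuclideanSpace ℝ (Fin n))) := by
      rintro rfl
      simp at hp
    obtain ⟨v, hv, -, -, H⟩ :=
      exists_infDist_decreasing_direction isClosed_singleton (singleton_nonempty (q A)) hpq
    refine ⟨v, hv, fun s hs => ?_⟩
    rw [lowerFun_empty, neg_neg] at hs
    simp only [infDist_singleton, dist_eq_norm] at H
    rw [lowerFun_empty, lowerFun_empty]
    linarith [H s hs]
  · simp only [lowerFun_of_nonempty hB'] at hp ⊢
    exact exists_sgnDist_increasing_direction hB hB' hp

/-- To see that a zero set of the level function is null one may disregard the points outside the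
interior of `A`. -/
theorem volume_levelFun_eq_zero_of_pos (hq : IsCenterSelection q) (hA : A ∈ JSets n)
    (hB : B ∈ JSets n) (hBA : B ⊆ A) (hne : A.Nonempty) (hx : x ∈ Ico (0 : ℝ) 1)
    (h : volume {p | levelFun q A B x p = 0 ∧ 0 < sgnDist p A} = 0) :
    volume {p | levelFun q A B x p = 0} = 0 := by
  refine measure_mono_null (fun p hp => ?_) (measure_union_null h
    (volume_lowerFun_eq_zero (q := q) (A := A) hB))
  rcases lt_or_ge 0 (sgnDist p A) with h0 | h0
  · exact Or.inl ⟨hp, h0⟩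
  · right
    have h1 := lowerFun_le_sgnDist hq hA hB hBA hne p
    rw [mem_ofPred_eq, levelFun_eq] at hp
    -- Where the signed distance to `A` is nonpositive, both summands are nonpositive, so a
    -- vanishing sum forces `lowerFun` to vanish, and its zero set is null.
    have h2 : (1 - x) * lowerFun q A B p = 0 :=
      le_antisymm (mul_nonpos_of_nonneg_of_nonpos (by linarith [hx.2]) (h1.trans h0))
        (by linarith [mul_nonpos_of_nonneg_of_nonpos hx.1 h0])
    exact (mul_eq_zero.1 h2).resolve_left (by linarith [hx.2])

/-- The zero set of the level function is null for every parameter in `(0, 1)` other than `1/2`. -/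
theorem volume_levelFun_eq_zero_of_ne_half (hq : IsCenterSelection q) (hA : A ∈ JSets n)
    (hB : B ∈ JSets n) (hBA : B ⊆ A) (hne : A.Nonempty) (hx : x ∈ Ioo (0 : ℝ) 1)
    (hx2 : x ≠ 1 / 2) : volume {p | levelFun q A B x p = 0} = 0 := by
  refine volume_levelFun_eq_zero_of_pos hq hA hB hBA hne ⟨hx.1.le, hx.2⟩ ?_
  refine measure_level_eq_zero volume (lipschitzWith_levelFun ⟨hx.1.le, hx.2.le⟩)
    measurableSet_levelFun_eq_zero_inter (fun p hp => hp.1) fun p hp => ?_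
  obtain ⟨hp0, hpA⟩ := hp
  have hx1 : 0 < 1 - x := by linarith [hx.2]
  rw [levelFun_eq] at hp0
  have hlow : lowerFun q A B p < 0 := by
    by_contra! h
    linarith [mul_pos hx.1 hpA, mul_nonneg hx1.le h]
  -- Move the more heavily weighted term at unit rate. The other is 1-Lipschitz and can undo at most
  -- its own weight, leaving the rate `|1 - 2x|`. At `x = 1/2` the two could cancel.
  rcases lt_or_gt_of_ne hx2 with h | h
  · obtain ⟨v, hv, H⟩ := exists_lowerFun_increasing_direction hB hlow
    refine ⟨1 - 2 * x, by linarith, _, neg_pos.2 hlow, fun s hs => ⟨p + s • v, ?_, ?_⟩⟩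
    · simp [dist_eq_norm, norm_smul, hv, abs_of_pos hs.1]
    · have h1 := H s ⟨hs.1.le, hs.2.le⟩
      have h2 := (lipschitzWith_sgnDist A).le_add_mul p (p + s • v)
      simp only [NNReal.coe_one, one_mul, dist_eq_norm, sub_add_cancel_left, norm_neg, norm_smul,
        hv, mul_one, Real.norm_of_nonneg hs.1.le] at h2
      rw [sub_zero, levelFun_eq]
      refine le_trans ?_ (le_abs_self _)
      have h3 := mul_le_mul_of_nonneg_left h1 hx1.le
      have h4 := mul_le_mul_of_nonneg_left h2 hx.1.le
      linarith
  · obtain ⟨v, hv, -, H⟩ := exists_sgnDist_decreasing_direction hA hpA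
    refine ⟨2 * x - 1, by linarith, _, hpA, fun s hs => ⟨p + s • v, ?_, ?_⟩⟩
    · simp [dist_eq_norm, norm_smul, hv, abs_of_pos hs.1]
    · have h1 := H s ⟨hs.1.le, hs.2.le⟩
      have h2 := (lipschitzWith_lowerFun (q := q) (A := A) (B := B)).le_add_mul (p + s • v) p
      simp only [NNReal.coe_one, one_mul, dist_eq_norm, add_sub_cancel_left, norm_smul,
        hv, mul_one, Real.norm_of_nonneg hs.1.le] at h2
      rw [sub_zero, levelFun_eq]
      refine le_trans ?_ (neg_le_abs _)
      have h3 := mul_le_mul_of_nonneg_left h1 hx.1.le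
      have h4 := mul_le_mul_of_nonneg_left h2 hx1.le
      linarith

theorem sgnDist_center_pos (hq : IsCenterSelection q) (hA : A ∈ JSets n) (hne : A.Nonempty) :
    0 < sgnDist (q A) A := by
  obtain ⟨a, ha⟩ := interior_nonempty_of_mem_JSets hA hne
  have haA := interior_subset ha
  refine lt_of_lt_of_le ?_ ((hq A hA hne).2 a haA)
  refine lt_of_le_of_ne ((sgnDist_nonneg_iff hA hne).2 haA) fun h => ?_
  exact ((sgnDist_eq_zero_iff hA hne).1 h.symm).2 ha

/-- The zero-measure condition always holds when the smaller set is empty. -/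
theorem zeroMeasureCondition_empty (hq : IsCenterSelection q) (hA : A ∈ JSets n)
    (hne : A.Nonempty) : ZeroMeasureCondition q A ∅ := by
  have hx : (1 / 2 : ℝ) ∈ Ico (0 : ℝ) 1 := by norm_num
  refine volume_levelFun_eq_zero_of_pos hq hA empty_mem_JSets (empty_subset A) hne hx ?_
  refine measure_level_eq_zero volume (lipschitzWith_levelFun ⟨hx.1, hx.2.le⟩)
    measurableSet_levelFun_eq_zero_inter (fun p hp => hp.1) fun p hp => ?_
  obtain ⟨hp0, hpA⟩ := hp
  rw [levelFun_eq, lowerFun_empty] at hp0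
  have hr : ‖p - q A‖ = sgnDist p A := by linarith
  obtain ⟨v, hv, hend, H⟩ := exists_sgnDist_decreasing_direction hA hpA
  set r := sgnDist p A
  obtain ⟨w, hw⟩ : ∃ w, w = r⁻¹ • (q A - p) := ⟨_, rfl⟩
  have hwn : ‖w‖ = 1 := by
    rw [hw, norm_smul, norm_sub_rev, hr, norm_inv, Real.norm_of_nonneg hpA.le,
      inv_mul_cancel₀ hpA.ne']
  have hrw : r • w = q A - p := by rw [hw, smul_smul, mul_inv_cancel₀ hpA.ne', one_smul]
  -- `v` points to a nearest frontier point and `w` to the center, both at distance `r`. If they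
  -- agreed, the center would lie on the frontier.
  have hvw : v ≠ w := by
    rintro rfl
    rw [hrw, add_sub_cancel] at hend
    exact (sgnDist_center_pos hq hA hne).ne' ((sgnDist_eq_zero_iff hA hne).2 hend)
  have hin : inner ℝ v w < 1 := (inner_lt_one_iff_real_of_norm_eq_one hv hwn).2 hvw
  -- Along `v` the depth in `A` falls at rate 1, while the distance to the center falls at rate at
  -- most `⟪v, w⟫`; each has weight `1/2`.
  refine ⟨(1 - inner ℝ v w) / 2, by linarith, r, hpA, fun s hs => ⟨p + s • v, ?_, ?_⟩⟩
  · simp [dist_eq_norm, norm_smul, hv, abs_of_pos hs.1]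
  · have h1 := H s ⟨hs.1.le, hs.2.le⟩
    have h2 : r - s * inner ℝ v w ≤ ‖p + s • v - q A‖ := by
      have h3 : p + s • v - q A = s • v - r • w := by rw [hrw]; abel
      have h4 := real_inner_le_norm (r • w - s • v) w
      rw [hwn, mul_one, inner_sub_left, real_inner_smul_left, real_inner_smul_left,
        real_inner_self_eq_norm_sq, hwn] at h4
      rw [h3, norm_sub_rev]
      linarith
    rw [sub_zero, levelFun_eq, lowerFun_empty]
    refine le_trans ?_ (neg_le_abs _)
    linarith

/-- Under the zero-measure condition, all zero sets of the level function are null. -/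
theorem volume_levelFun_eq_zero (hq : IsCenterSelection q) (hA : A ∈ JSets n)
    (hB : B ∈ JSets n) (hBA : B ⊆ A) (hne : A.Nonempty) (hZ : ZeroMeasureCondition q A B)
    (hx : x ∈ Icc (0 : ℝ) 1) : volume {p | levelFun q A B x p = 0} = 0 := by
  rcases eq_or_ne x (1 / 2) with rfl | h2
  · exact hZ
  rcases hx.1.eq_or_lt with rfl | h0
  · simpa [levelFun_eq] using volume_lowerFun_eq_zero hB
  rcases hx.2.eq_or_lt with rfl | h1
  · have : {p | levelFun q A B 1 p = 0} = frontier A := by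
      ext p
      rw [mem_ofPred_eq, levelFun_eq, ← sgnDist_eq_zero_iff hA hne]
      simp
    rw [this, hA.2.2]
  · exact volume_levelFun_eq_zero_of_ne_half hq hA hB hBA hne ⟨h0, h1⟩ h2

end LevelFunction

/-! ### Exact measure of the average for a difference treated as one component -/

section SimpleAverage

open Metric Filter Topology

variable {n : ℕ} {q : Set (EuclideanSpace ℝ (Fin n)) → EuclideanSpace ℝ (Fin n)}
  {A B : Set (EuclideanSpace ℝ (Fin n))} {N t : ℝ}

/-- Dominated convergence for indicators, with the finite-measure set `A` as the dominating set. -/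
theorem continuousOn_volume_real_of_ae_eventually_mem_iff
    {D : ℝ → Set (EuclideanSpace ℝ (Fin n))} {I : Set ℝ} (hD : ∀ x ∈ I, MeasurableSet (D x))
    (hA : MeasurableSet A) (hfin : volume A ≠ ⊤) (hDA : ∀ x ∈ I, D x ⊆ A)
    (h : ∀ x ∈ I, ∀ᵐ p, ∀ᶠ y in 𝓝[I] x, p ∈ D y ↔ p ∈ D x) :
    ContinuousOn (fun x => volume.real (D x)) I := by
  intro x hx
  -- Intersecting with the condition `y ∈ I` empties the sets for parameters outside `I`, where
  -- neither measurability nor inclusion in `A` is known.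
  have key : Tendsto (fun y => volume (D y ∩ {_p | y ∈ I})) (𝓝[I] x) (𝓝 (volume (D x))) := by
    refine tendsto_measure_of_ae_tendsto_indicator (𝓝[I] x) (hD x hx) (fun y => ?_) hA hfin
      (Eventually.of_forall fun y p hp => hDA y hp.2 hp.1) ?_
    · by_cases hy : y ∈ I
      · simpa [hy] using hD y hy
      · simp [hy]
    · filter_upwards [h x hx] with p hp
      filter_upwards [hp, self_mem_nhdsWithin] with y hy hyI
      exact ⟨fun h => hy.1 h.1, fun h => ⟨hy.2 h, hyI⟩⟩
  have key' : Tendsto (fun y => volume (D y)) (𝓝[I] x) (𝓝 (volume (D x))) := by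
    refine key.congr' ?_
    filter_upwards [self_mem_nhdsWithin] with y hy
    congr 1
    ext p
    exact and_iff_left hy
  exact (ENNReal.tendsto_toReal (measure_ne_top_of_subset (hDA x hx) hfin)).comp key'

theorem targetMeasure_mem_Icc (hA : A ∈ JSets n) (hBA : B ⊆ A) (ht : t ∈ Icc (0 : ℝ) 1) :
    targetMeasure t A B ∈ Icc (volume.real B) (volume.real A) := by
  have h := measureReal_mono hBA (volume_ne_top_of_mem_JSets hA)
  unfold targetMeasure
  constructor
  · nlinarith [mul_nonneg ht.1 (sub_nonneg.2 h)]
  · nlinarith [mul_nonneg (sub_nonneg.2 ht.2) (sub_nonneg.2 h)]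

variable [Nontrivial (EuclideanSpace ℝ (Fin n))]

/-- Off the null zero set at `x`, the sign of the level function at a fixed point persists for
nearby parameters. -/
theorem continuousOn_volume_real_distAvg (hq : IsCenterSelection q) (hA : A ∈ JSets n)
    (hB : B ∈ JSets n) (hBA : B ⊆ A) (hne : A.Nonempty) (hZ : ZeroMeasureCondition q A B) :
    ContinuousOn (fun x => volume.real (distAvg q x A B)) (Icc 0 1) := by
  refine continuousOn_volume_real_of_ae_eventually_mem_iff
    (fun x _ => (isClosed_distAvg x).measurableSet) (measurableSet_of_mem_JSets hA)
    (volume_ne_top_of_mem_JSets hA) (fun x hx => (distAvg_mono hq hA hB hBA hne hx.2).trans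
      (distAvg_one hA hne).subset) fun x hx => ?_
  have h0 : ∀ᵐ p, levelFun q A B x p ≠ 0 := by
    rw [ae_iff]
    simpa using volume_levelFun_eq_zero hq hA hB hBA hne hZ hx
  filter_upwards [h0] with p hp
  have hc : Continuous fun y => levelFun q A B y p := by
    simp only [levelFun_eq]
    fun_prop
  simp only [mem_distAvg hne]
  refine Eventually.filter_mono nhdsWithin_le_nhds ?_
  rcases lt_or_gt_of_ne hp with h | h
  · filter_upwards [(hc.tendsto x).eventually_lt_const h] with y hy
    exact ⟨fun h' => absurd h' (not_le.2 hy), fun h' => absurd h' (not_le.2 h)⟩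
  · filter_upwards [(hc.tendsto x).eventually_const_lt h] with y hy
    exact ⟨fun _ => h.le, fun _ => hy.le⟩

theorem exists_volume_real_distAvg_eq (hq : IsCenterSelection q) (hA : A ∈ JSets n)
    (hB : B ∈ JSets n) (hBA : B ⊆ A) (hne : A.Nonempty) (hZ : ZeroMeasureCondition q A B)
    (ht : t ∈ Icc (0 : ℝ) 1) :
    ∃ x ∈ Icc (0 : ℝ) 1, volume.real (distAvg q x A B) = targetMeasure t A B := by
  have h := intermediate_value_Icc zero_le_one
    (continuousOn_volume_real_distAvg hq hA hB hBA hne hZ)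
  have h0 : volume.real (distAvg q 0 A B) = volume.real B :=
    measureReal_congr (distAvg_zero_ae_eq hB hne)
  simp only [h0, distAvg_one hA hne] at h
  exact h (targetMeasure_mem_Icc hA hBA ht)

/-- As `[0,1] ⊆ [-N,N]`, some admissible parameter has error zero, so every minimizer does. -/
theorem volume_real_distAvg_epsilon (hq : IsCenterSelection q) (hA : A ∈ JSets n)
    (hB : B ∈ JSets n) (hBA : B ⊆ A) (hne : A.Nonempty) (hZ : ZeroMeasureCondition q A B)
    (hN : 1 ≤ N) (ht : t ∈ Icc (0 : ℝ) 1) :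
    volume.real (distAvg q (Classical.epsilon fun x => x ∈ reparamSet q N t A B) A B) =
      targetMeasure t A B := by
  obtain ⟨x, hx, hxt⟩ := exists_volume_real_distAvg_eq hq hA hB hBA hne hZ ht
  have hxN : x ∈ Icc (-N) N := ⟨by linarith [hx.1], by linarith [hx.2]⟩
  have hmem : x ∈ reparamSet q N t A B := by
    refine ⟨hxN, fun y _ => ?_⟩
    simp only [mem_ofPred_eq, hxt, sub_self, abs_zero]
    exact abs_nonneg _
  have hg := Classical.epsilon_spec (p := fun x => x ∈ reparamSet q N t A B) ⟨x, hmem⟩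
  have h := hg.2 hxN
  simp only [mem_ofPred_eq, hxt, sub_self, abs_zero] at h
  exact sub_eq_zero.1 (abs_nonpos_iff.1 h)

omit [Nontrivial (EuclideanSpace ℝ (Fin n))] in
theorem isClosed_offset (B : Set (EuclideanSpace ℝ (Fin n))) (r : ℝ) : IsClosed (offset B r) :=
  isClosed_le (continuous_infDist_pt B) continuous_const

theorem volume_infDist_eq_zero (hB : IsClosed B) (hne : B.Nonempty) {r : ℝ} (hr : 0 < r) :
    volume {p | infDist p B = r} = 0 := by
  refine measure_level_eq_zero volume (lipschitz_infDist_pt B)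
    (isClosed_eq (continuous_infDist_pt B) continuous_const).measurableSet (fun p hp => hp)
    fun p hp => ?_
  rw [mem_ofPred_eq] at hp
  have hpB : p ∉ B := fun h => hr.ne' (hp ▸ infDist_zero_of_mem h)
  obtain ⟨v, hv, -, -, H⟩ := exists_infDist_decreasing_direction hB hne hpB
  rw [hp] at H
  refine ⟨1, one_pos, r, hr, fun s hs => ⟨p + s • v, ?_, ?_⟩⟩
  · simp [dist_eq_norm, norm_smul, hv, abs_of_pos hs.1]
  · refine le_trans ?_ (neg_le_abs _)
    linarith [H s ⟨hs.1.le, hs.2.le⟩]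

omit [Nontrivial (EuclideanSpace ℝ (Fin n))] in
theorem offset_zero (hB : IsClosed B) (hne : B.Nonempty) : offset B 0 = B := by
  ext p
  rw [offset, mem_ofPred_eq, hB.mem_iff_infDist_zero hne]
  exact ⟨fun h => h.antisymm infDist_nonneg, fun h => h.le⟩

theorem volume_frontier_offset (hB : B ∈ JSets n) (hne : B.Nonempty) {r : ℝ} (hr : 0 ≤ r) :
    volume (frontier (offset B r)) = 0 := by
  rcases hr.eq_or_lt with rfl | h
  · rw [offset_zero (isClosed_of_mem_JSets hB) hne, hB.2.2]
  · exact measure_mono_null (frontier_le_subset_eq (continuous_infDist_pt B) continuous_const)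
      (volume_infDist_eq_zero (isClosed_of_mem_JSets hB) hne h)

theorem continuousOn_volume_real_offset_inter (hA : A ∈ JSets n) (hB : B ∈ JSets n)
    (hne : B.Nonempty) : ContinuousOn (fun r => volume.real (offset B r ∩ A)) (Ici 0) := by
  refine continuousOn_volume_real_of_ae_eventually_mem_iff
    (fun r _ => (isClosed_offset B r).measurableSet.inter (measurableSet_of_mem_JSets hA))
    (measurableSet_of_mem_JSets hA) (volume_ne_top_of_mem_JSets hA)
    (fun r _ => inter_subset_right) fun r hr => ?_
  -- The level set for `r = 0` is `B`, which need not be null; its points are harmless because they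
  -- lie in every offset with nonnegative radius.
  have h0 : ∀ᵐ p, infDist p B = r → p ∈ B := by
    rw [ae_iff]
    rcases (mem_Ici.1 hr).eq_or_lt with rfl | h
    · refine measure_mono_null (fun p hp => ?_) measure_empty
      rw [mem_ofPred_eq, ← (isClosed_of_mem_JSets hB).mem_iff_infDist_zero hne] at hp
      exact hp id
    · refine measure_mono_null (fun p hp => ?_)
        (volume_infDist_eq_zero (isClosed_of_mem_JSets hB) hne h)
      rw [mem_ofPred_eq, Classical.not_imp] at hp
      exact hp.1
  filter_upwards [h0] with p hp
  have key : ∀ᶠ y in 𝓝[Ici 0] r, p ∈ offset B y ↔ p ∈ offset B r := by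
    by_cases hpB : p ∈ B
    · filter_upwards [self_mem_nhdsWithin] with y hy
      simp only [offset, mem_ofPred_eq, infDist_zero_of_mem hpB]
      exact ⟨fun _ => hr, fun _ => hy⟩
    · refine Eventually.filter_mono nhdsWithin_le_nhds ?_
      simp only [offset, mem_ofPred_eq]
      rcases lt_or_gt_of_ne (mt hp hpB) with h | h
      · filter_upwards [lt_mem_nhds h] with y hy
        exact ⟨fun _ => h.le, fun _ => hy.le⟩
      · filter_upwards [gt_mem_nhds h] with y hy
        exact ⟨fun h' => absurd h' (not_le.2 hy), fun h' => absurd h' (not_le.2 h)⟩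
  filter_upwards [key] with y hy
  rw [mem_inter_iff, mem_inter_iff, hy]

theorem radiusSet_nonempty (hA : A ∈ JSets n) (hB : B ∈ JSets n) (hBA : B ⊆ A)
    (hne : B.Nonempty) (ht : t ∈ Icc (0 : ℝ) 1) : (radiusSet t A B).Nonempty := by
  obtain ⟨b, hb⟩ := hne
  obtain ⟨R, hR0, hR⟩ := hA.1.subset_closedBall_lt 0 b
  have h := intermediate_value_Icc hR0.le
    ((continuousOn_volume_real_offset_inter hA hB ⟨b, hb⟩).mono Icc_subset_Ici_self)
  have h1 : offset B 0 ∩ A = B := by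
    rw [offset_zero (isClosed_of_mem_JSets hB) ⟨b, hb⟩, inter_eq_left.2 hBA]
  have h2 : offset B R ∩ A = A :=
    inter_eq_right.2 fun p hp => (infDist_le_dist_of_mem hb).trans (hR hp)
  simp only [h1, h2] at h
  obtain ⟨r, hr, hrt⟩ := h (targetMeasure_mem_Icc hA hBA ht)
  exact ⟨r, hr.1, hrt⟩

/-- The properties shared by all averages of the nested sets `B ⊆ A`. -/
structure IsNestedAverage {n : ℕ} (t : ℝ) (A B S : Set (EuclideanSpace ℝ (Fin n))) : Prop where
  mem : S ∈ JSets n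
  le : B ⊆ S
  ge : S ⊆ A
  volume_real : volume.real S = targetMeasure t A B

omit [Nontrivial (EuclideanSpace ℝ (Fin n))] in
theorem isNestedAverage_ci (hA : A ∈ JSets n) (hB : B ∈ JSets n)
    {D : Set (EuclideanSpace ℝ (Fin n))} (hD : IsClosed D) (hBD : B ≤ᵐ[volume] D) (hDA : D ⊆ A)
    (h0 : volume (frontier D) = 0) (hv : volume.real D = targetMeasure t A B) :
    IsNestedAverage t A B (ci D) where
  mem := ci_mem_JSets (hA.1.subset hDA) h0
  le := subset_of_ae_le hB isClosed_closure (hBD.trans (ci_ae_eq h0).symm.le)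
  ge := (ci_subset_closure D).trans (hD.closure_eq.subset.trans hDA)
  volume_real := (measureReal_congr (ci_ae_eq h0)).trans hv

theorem isNestedAverage_simpleAvg (hq : IsCenterSelection q) (hA : A ∈ JSets n)
    (hB : B ∈ JSets n) (hBA : B ⊆ A) (hN : 1 ≤ N) (ht : t ∈ Icc (0 : ℝ) 1) :
    IsNestedAverage t A B (simpleAvg q N t A B) := by
  rcases A.eq_empty_or_nonempty with rfl | hne
  · obtain rfl : B = ∅ := subset_empty_iff.1 hBA
    -- Both branches of the definition give `∅`, so the zero-measure condition, which here involves
    -- the unconstrained value `q ∅`, is irrelevant.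
    have h : simpleAvg q N t ∅ ∅ = (∅ : Set (EuclideanSpace ℝ (Fin n))) := by
      simp [simpleAvg, distAvg, ci]
    rw [h]
    exact ⟨hA, Subset.rfl, Subset.rfl, by simp [targetMeasure]⟩
  unfold simpleAvg
  split_ifs with hZ
  · have hv := volume_real_distAvg_epsilon hq hA hB hBA hne hZ hN ht
    set g := Classical.epsilon fun x => x ∈ reparamSet q N t A B
    have hτ := targetMeasure_mem_Icc hA hBA ht
    have hfin : ∀ x, volume (distAvg q x A B) ≠ ⊤ := fun x =>
      (isBounded_distAvg hq hA hB hBA hne x).measure_lt_top.ne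
    have hBt := volume_ne_top_of_mem_JSets hB
    have hAt := volume_ne_top_of_mem_JSets hA
    -- The minimizer may leave `[0,1]`, where null zero sets are not available. There monotonicity
    -- and the exact measure force the distance average to equal `B` or `A` almost everywhere, and
    -- `ci` recovers that set exactly.
    rcases le_or_gt g 0 with hg0 | hg0
    · have h1 : distAvg q g A B =ᵐ[volume] distAvg q 0 A B := by
        refine ae_eq_of_subset_of_measure_ge (distAvg_mono hq hA hB hBA hne hg0) ?_
          (isClosed_distAvg g).measurableSet.nullMeasurableSet (hfin 0)
        rw [measure_congr (distAvg_zero_ae_eq hB hne), ← ENNReal.toReal_le_toReal hBt (hfin g)]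
        exact hτ.1.trans hv.ge
      have h2 := h1.trans (distAvg_zero_ae_eq hB hne)
      rw [ci_eq_of_ae_eq hB (isClosed_distAvg g) h2]
      exact ⟨hB, Subset.rfl, hBA, (measureReal_congr h2).symm.trans hv⟩
    rcases le_or_gt 1 g with hg1 | hg1
    · have h1 : A =ᵐ[volume] distAvg q g A B := by
        refine ae_eq_of_subset_of_measure_ge
          ((distAvg_one hA hne).symm.subset.trans (distAvg_mono hq hA hB hBA hne hg1)) ?_
          (measurableSet_of_mem_JSets hA).nullMeasurableSet (hfin g)
        rw [← ENNReal.toReal_le_toReal (hfin g) hAt]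
        exact hv.le.trans hτ.2
      rw [ci_eq_of_ae_eq hA (isClosed_distAvg g) h1.symm]
      exact ⟨hA, hBA, Subset.rfl, (measureReal_congr h1).trans hv⟩
    · refine isNestedAverage_ci hA hB (isClosed_distAvg g) ?_ ?_ ?_ hv
      · exact (distAvg_zero_ae_eq hB hne).symm.le.trans
          (Eventually.of_forall (distAvg_mono hq hA hB hBA hne hg0.le))
      · exact (distAvg_mono hq hA hB hBA hne hg1.le).trans (distAvg_one hA hne).subset
      · refine measure_mono_null ?_
          (volume_levelFun_eq_zero hq hA hB hBA hne hZ ⟨hg0.le, hg1.le⟩)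
        rw [distAvg, if_neg hne.ne_empty]
        exact (frontier_le_subset_eq continuous_const (continuous_levelFun g)).trans
          fun p hp => hp.symm
  · have hBne : B.Nonempty := by
      by_contra h
      rw [not_nonempty_iff_eq_empty] at h
      subst h
      exact hZ (zeroMeasureCondition_empty hq hA hne)
    obtain ⟨hr, hv⟩ := Classical.epsilon_spec (p := fun r => r ∈ radiusSet t A B)
      (radiusSet_nonempty hA hB hBA hBne ht)
    refine isNestedAverage_ci hA hB ((isClosed_offset B _).inter (isClosed_of_mem_JSets hA)) ?_
      inter_subset_right ?_ hv
    · exact Eventually.of_forall fun p hp => ⟨(infDist_zero_of_mem hp).trans_le hr, hBA hp⟩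
    · exact volume_frontier_inter_eq_zero (volume_frontier_offset hB hBne hr) hA.2.2

end SimpleAverage

/-! ### Decomposing the difference into components -/

section NestedAverage

open Metric Filter Topology

variable {n : ℕ} {q : Set (EuclideanSpace ℝ (Fin n)) → EuclideanSpace ℝ (Fin n)}
  {A B C D W : Set (EuclideanSpace ℝ (Fin n))} {N ε t : ℝ}

/-- `W` is a union of connected components of `D`. -/
structure IsComponentUnion {n : ℕ} (D W : Set (EuclideanSpace ℝ (Fin n))) : Prop where
  subset : W ⊆ D
  component_subset : ∀ x ∈ W, connectedComponentIn D x ⊆ W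

theorem isComponentUnion_of_mem_components (hC : C ∈ components D) : IsComponentUnion D C := by
  obtain ⟨x, -, rfl⟩ := hC
  exact ⟨connectedComponentIn_subset D x, fun y hy => (connectedComponentIn_eq hy).symm.subset⟩

theorem isComponentUnion_sUnion {𝒲 : Set (Set (EuclideanSpace ℝ (Fin n)))}
    (h : 𝒲 ⊆ components D) : IsComponentUnion D (⋃₀ 𝒲) where
  subset := sUnion_subset fun _ hW => (isComponentUnion_of_mem_components (h hW)).subset
  component_subset := by
    rintro x ⟨C, hC, hx⟩
    exact ((isComponentUnion_of_mem_components (h hC)).component_subset x hx).trans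
      (subset_sUnion_of_mem hC)

theorem sUnion_components (D : Set (EuclideanSpace ℝ (Fin n))) : ⋃₀ components D = D := by
  refine (isComponentUnion_sUnion Subset.rfl).subset.antisymm fun x hx => ?_
  exact ⟨_, ⟨x, hx, rfl⟩, mem_connectedComponentIn hx⟩

theorem pairwiseDisjoint_components (D : Set (EuclideanSpace ℝ (Fin n))) :
    (components D).PairwiseDisjoint id := by
  rintro _ ⟨x, hx, rfl⟩ _ ⟨y, hy, rfl⟩ hne
  refine disjoint_left.2 fun z hzx hzy => hne ?_
  exact (connectedComponentIn_eq hzx).trans (connectedComponentIn_eq hzy).symm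

/-- Components are relatively closed: a connected set stays connected after adding a point of its
closure. -/
theorem closure_inter_subset_of_mem_components (hC : C ∈ components D) : closure C ∩ D ⊆ C := by
  rintro y ⟨hyC, hyD⟩
  obtain ⟨x, hx, rfl⟩ := hC
  refine (isPreconnected_connectedComponentIn.subset_closure (subset_insert y _) ?_)
    |>.subset_connectedComponentIn (mem_insert_of_mem _ (mem_connectedComponentIn hx)) ?_
    (mem_insert y _)
  · exact insert_subset hyC subset_closure
  · exact insert_subset hyD (connectedComponentIn_subset D x)

/-- Near a closure point that is off both frontiers and outside `B`, a ball lies in `A \ B`. Being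
connected, it lies inside one component, hence wholly in `W` once it meets `W`. -/
theorem frontier_union_subset_of_isComponentUnion (hB : IsClosed B)
    (hBA : B ⊆ A) (hW : IsComponentUnion (A \ B) W) :
    frontier (B ∪ W) ⊆ frontier A ∪ frontier B := by
  rintro p ⟨hpc, hpi⟩
  have hWA : W ⊆ A := hW.subset.trans sdiff_subset
  by_contra hp
  rw [mem_union, not_or] at hp
  have hpA : p ∈ interior A := by
    by_contra h
    exact hp.1 ⟨closure_mono (union_subset hBA hWA) hpc, h⟩
  have hpB : p ∉ B := fun h =>
    hp.2 ⟨subset_closure h, fun h' => hpi (interior_mono subset_union_left h')⟩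
  obtain ⟨r, hr, hball⟩ := isOpen_iff.1 (isOpen_interior.sdiff hB) p ⟨hpA, hpB⟩
  have hballD : ball p r ⊆ A \ B := hball.trans (sdiff_subset_sdiff_left interior_subset)
  have hcomp : ∀ z ∈ ball p r, z ∈ W → ball p r ⊆ W := fun z hz hzW =>
    ((convex_ball p r).isPreconnected.subset_connectedComponentIn hz hballD).trans
      (hW.component_subset z hzW)
  obtain ⟨z, hz, hzW⟩ := mem_closure_iff.1 hpc (ball p r) isOpen_ball (mem_ball_self hr)
  have hzW' : z ∈ W := hzW.resolve_left (hballD hz).2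
  exact hpi (interior_maximal ((hcomp z hz hzW').trans subset_union_right) isOpen_ball
    (mem_ball_self hr))

theorem volume_frontier_union_eq_zero (hA : A ∈ JSets n) (hB : B ∈ JSets n) (hBA : B ⊆ A)
    (hW : IsComponentUnion (A \ B) W) : volume (frontier (B ∪ W)) = 0 :=
  measure_mono_null (frontier_union_subset_of_isComponentUnion (isClosed_of_mem_JSets hB)
    hBA hW) (measure_union_null hA.2.2 hB.2.2)

/-- Measurability comes from the null boundary of `B ∪ W`, which also covers infinite unions of
components. -/
theorem nullMeasurableSet_of_isComponentUnion (hA : A ∈ JSets n) (hB : B ∈ JSets n) (hBA : B ⊆ A)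
    (hW : IsComponentUnion (A \ B) W) : NullMeasurableSet W := by
  have h1 : NullMeasurableSet (B ∪ W) :=
    nullMeasurableSet_of_null_frontier (volume_frontier_union_eq_zero hA hB hBA hW)
  have h2 : (B ∪ W) \ B = W := by
    rw [union_sdiff_left]
    exact sdiff_eq_left.2 (disjoint_left.2 fun x hx => (hW.subset hx).2)
  rw [← h2]
  exact h1.diff (measurableSet_of_mem_JSets hB).nullMeasurableSet

/-- When `A \ B` has finitely many components, adjoining one of them to `B` gives a regular closed
set. -/
theorem ci_union_of_mem_components (hA : A ∈ JSets n) (hB : B ∈ JSets n)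
    (hfin : (components (A \ B)).Finite) (hC : C ∈ components (A \ B)) :
    ci (B ∪ C) = B ∪ C := by
  have hCA : C ⊆ A \ B := (isComponentUnion_of_mem_components hC).subset
  have hBc := isClosed_of_mem_JSets hB
  apply Subset.antisymm
  · refine (ci_subset_closure _).trans ?_
    rw [closure_union, hBc.closure_eq]
    refine union_subset subset_union_left fun y hy => ?_
    have hyA : y ∈ A := (isClosed_of_mem_JSets hA).closure_subset_iff.2 (hCA.trans sdiff_subset) hy
    by_cases hyB : y ∈ B
    · exact Or.inl hyB
    · exact Or.inr (closure_inter_subset_of_mem_components hC ⟨hy, hyA, hyB⟩)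
  · refine union_subset (hB.2.1.symm.subset.trans (ci_mono subset_union_left)) fun x hx => ?_
    -- Finiteness makes `K` closed. Off `K` the set `A` is contained in `C`, so regularity of `A` at
    -- `x` transfers to `B ∪ C`.
    set K := B ∪ ⋃ C' ∈ components (A \ B) \ {C}, closure C'
    have hK : IsClosed K := hBc.union
      ((hfin.subset sdiff_subset).isClosed_biUnion fun _ _ => isClosed_closure)
    have hxK : x ∈ Kᶜ := by
      rintro (h | h)
      · exact (hCA hx).2 h
      · simp only [mem_iUnion] at h
        obtain ⟨C', ⟨hC', hne⟩, hxC'⟩ := h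
        have hx' := closure_inter_subset_of_mem_components hC' ⟨hxC', hCA hx⟩
        exact disjoint_left.1 (pairwiseDisjoint_components _ hC' hC hne) hx' hx
    have hsub : Kᶜ ∩ A ⊆ C := by
      rintro y ⟨hyK, hyA⟩
      have hyD : y ∈ A \ B := ⟨hyA, fun h => hyK (Or.inl h)⟩
      by_contra hyC
      rw [← sUnion_components (A \ B)] at hyD
      obtain ⟨C', hC', hy⟩ := hyD
      refine hyK (Or.inr (mem_biUnion ⟨hC', ?_⟩ (subset_closure hy)))
      rintro rfl
      exact hyC hy
    have hint : Kᶜ ∩ interior A ⊆ interior (B ∪ C) :=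
      interior_maximal ((inter_subset_inter_right _ interior_subset).trans
        (hsub.trans subset_union_right)) (hK.isOpen_compl.inter isOpen_interior)
    refine closure_mono hint (hK.isOpen_compl.inter_closure ⟨hxK, ?_⟩)
    have := (hCA hx).1
    rwa [← hA.2.1] at this

/-- The pieces come from a finite partition of `A \ B` into unions of components. -/
theorem exists_pieces_eq_image (hA : A ∈ JSets n) (hB : B ∈ JSets n) (hBA : B ⊆ A) (hne : A ≠ B)
    (hε : 0 < ε) :
    ∃ 𝒲 : Set (Set (EuclideanSpace ℝ (Fin n))), 𝒲.Finite ∧ 𝒲.Nonempty ∧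
      (∀ W ∈ 𝒲, IsComponentUnion (A \ B) W) ∧ 𝒲.PairwiseDisjoint id ∧ ⋃₀ 𝒲 = A \ B ∧
      pieces ε A B = (fun W => ci (B ∪ W)) '' 𝒲 := by
  unfold pieces
  -- With finitely many components `ci` changes nothing, so both cases of the definition take the
  -- same form.
  split_ifs with hfin
  · refine ⟨components (A \ B), hfin, ?_, fun W => isComponentUnion_of_mem_components,
      pairwiseDisjoint_components _, sUnion_components _, ?_⟩
    · obtain ⟨x, hx⟩ : (A \ B).Nonempty :=
        sdiff_nonempty.2 fun h => hne (h.antisymm hBA)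
      exact ⟨_, x, hx, rfl⟩
    · ext P
      constructor
      · rintro ⟨C, hC, rfl⟩
        exact ⟨C, hC, ci_union_of_mem_components hA hB hfin hC⟩
      · rintro ⟨C, hC, rfl⟩
        exact ⟨C, hC, ci_union_of_mem_components hA hB hfin hC⟩
  · set big := {C | C ∈ components (A \ B) ∧ ENNReal.ofReal ε ≤ volume C} with hbig
    set small := {C | C ∈ components (A \ B) ∧ volume C < ENNReal.ofReal ε} with hsmall
    have hsU : IsComponentUnion (A \ B) (⋃₀ small) := isComponentUnion_sUnion fun C hC => hC.1
    have hdis : ∀ C ∈ big, Disjoint (⋃₀ small) C := fun C hC => by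
      refine disjoint_sUnion_left.2 fun C' hC' => ?_
      refine pairwiseDisjoint_components _ hC'.1 hC.1 ?_
      rintro rfl
      exact not_le.2 hC'.2 hC.2
    refine ⟨insert (⋃₀ small) big, ?_, insert_nonempty _ _, ?_, ?_, ?_, ?_⟩
    · refine Finite.insert _ ?_
      -- Only finitely many disjoint sets of measure at least `ε` fit into `A`.
      have h := Measure.finite_const_le_meas_of_disjoint_iUnion₀ volume
        (ε := ENNReal.ofReal ε) (ENNReal.ofReal_pos.2 hε)
        (As := fun C : components (A \ B) => (C : Set (EuclideanSpace ℝ (Fin n))))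
        (fun C => nullMeasurableSet_of_isComponentUnion hA hB hBA
          (isComponentUnion_of_mem_components C.2))
        (fun C C' hCC' => (pairwiseDisjoint_components _ C.2 C'.2
          (fun h => hCC' (Subtype.ext h))).aedisjoint) (by
          refine measure_ne_top_of_subset (iUnion_subset fun C => ?_)
            (volume_ne_top_of_mem_JSets hA)
          exact (isComponentUnion_of_mem_components C.2).subset.trans sdiff_subset)
      refine (h.image Subtype.val).subset fun C hC => ?_
      exact ⟨⟨C, hC.1⟩, hC.2, rfl⟩
    · rintro W (rfl | hW)
      · exact hsU
      · exact isComponentUnion_of_mem_components hW.1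
    · refine (((pairwiseDisjoint_components (A \ B)).subset fun C hC => hC.1).insert
        fun C hC _ => hdis C hC)
    · rw [sUnion_insert]
      refine (union_subset hsU.subset
        (isComponentUnion_sUnion fun C hC => hC.1).subset).antisymm fun x hx => ?_
      obtain ⟨C, hC, hxC⟩ := (sUnion_components (A \ B)).symm.subset hx
      rcases lt_or_ge (volume C) (ENNReal.ofReal ε) with h | h
      · exact Or.inl ⟨C, ⟨hC, h⟩, hxC⟩
      · exact Or.inr ⟨C, ⟨hC, h⟩, hxC⟩
    · rw [image_insert_eq, insert_eq, union_comm]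
      congr 1
      ext P
      constructor
      · rintro ⟨C, hC, h, rfl⟩
        exact ⟨C, ⟨hC, h⟩, rfl⟩
      · rintro ⟨C, ⟨hC, h⟩, rfl⟩
        exact ⟨C, hC, h, rfl⟩

/-- Averages over the parts of a partition of `A \ B` combine to an average of `A` and `B`. -/
theorem isNestedAverage_biUnion (hA : A ∈ JSets n) (hB : B ∈ JSets n) (hBA : B ⊆ A)
    {𝒲 : Set (Set (EuclideanSpace ℝ (Fin n)))} (hfin : 𝒲.Finite) (hne : 𝒲.Nonempty)
    (hW : ∀ W ∈ 𝒲, IsComponentUnion (A \ B) W) (hd : 𝒲.PairwiseDisjoint id)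
    (hU : ⋃₀ 𝒲 = A \ B) {S : Set (EuclideanSpace ℝ (Fin n)) → Set (EuclideanSpace ℝ (Fin n))}
    (hS : ∀ W ∈ 𝒲, IsNestedAverage t (ci (B ∪ W)) B (S W)) :
    IsNestedAverage t A B (⋃ W ∈ 𝒲, S W) := by
  have hAt := volume_ne_top_of_mem_JSets hA
  have hBm := measurableSet_of_mem_JSets hB
  have hSm : ∀ W ∈ 𝒲, MeasurableSet (S W) := fun W h => measurableSet_of_mem_JSets (hS W h).mem
  have hPA : ∀ W ∈ 𝒲, ci (B ∪ W) ⊆ A := fun W h =>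
    (ci_mono (union_subset hBA ((hW W h).subset.trans sdiff_subset))).trans hA.2.1.subset
  have hBX : B ⊆ ⋃ W ∈ 𝒲, S W := by
    obtain ⟨W, h⟩ := hne
    exact (hS W h).le.trans (subset_biUnion_of_mem h)
  have hXA : ⋃ W ∈ 𝒲, S W ⊆ A := iUnion₂_subset fun W h => (hS W h).ge.trans (hPA W h)
  have hX : ⋃ W ∈ 𝒲, S W ∈ JSets n := biUnion_mem_JSets hfin fun W h => (hS W h).mem
  refine ⟨hX, hBX, hXA, ?_⟩
  have hWm : ∀ W ∈ 𝒲, NullMeasurableSet W := fun W h =>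
    nullMeasurableSet_of_isComponentUnion hA hB hBA (hW W h)
  have hWt : ∀ W ∈ 𝒲, volume W ≠ ⊤ := fun W h =>
    measure_ne_top_of_subset ((hW W h).subset.trans sdiff_subset) hAt
  -- Outside `B`, each partial average stays in its own part up to a null set, so the added portions
  -- are almost disjoint and their measures sum.
  have hSW : ∀ W ∈ 𝒲, S W \ B ≤ᵐ[volume] W := fun W h => by
    have h1 := ci_ae_eq (volume_frontier_union_eq_zero hA hB hBA (hW W h))
    filter_upwards [h1.le] with x hx hxS
    exact (hx ((hS W h).ge hxS.1)).resolve_left hxS.2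
  have hvol : ∀ W ∈ 𝒲, volume.real (S W \ B) = t * volume.real W := fun W h => by
    have h1 : volume.real (ci (B ∪ W)) = volume.real B + volume.real W := by
      rw [measureReal_congr (ci_ae_eq (volume_frontier_union_eq_zero hA hB hBA (hW W h)))]
      exact measureReal_union₀ (hWm W h) (disjoint_left.2 fun x hx hxW =>
        ((hW W h).subset hxW).2 hx).aedisjoint (volume_ne_top_of_mem_JSets hB) (hWt W h)
    rw [measureReal_sdiff (hS W h).le hBm (volume_ne_top_of_mem_JSets (hS W h).mem), (hS W h).volume_real,
      targetMeasure, h1]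
    ring
  have hWsum : ∑ W ∈ hfin.toFinset, volume.real W = volume.real A - volume.real B := by
    rw [← measureReal_sdiff hBA hBm, ← hU, sUnion_eq_biUnion]
    have h := measureReal_biUnion_finset₀ (μ := volume) (s := hfin.toFinset) (f := id)
      (by rw [hfin.coe_toFinset]; exact hd.aedisjoint)
      (fun W h => hWm W (hfin.mem_toFinset.1 h)) (fun W h => hWt W (hfin.mem_toFinset.1 h))
    simp only [hfin.mem_toFinset, id] at h
    exact h.symm
  have hSsum : volume.real (⋃ W ∈ 𝒲, S W \ B) = ∑ W ∈ hfin.toFinset, volume.real (S W \ B) := by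
    have h := measureReal_biUnion_finset₀ (μ := volume) (s := hfin.toFinset)
      (f := fun W => S W \ B) (by
        rw [hfin.coe_toFinset]
        intro W h W' h' hne
        refine measure_mono_null_ae ((hSW W h).inter (hSW W' h')) ?_
        rw [show W ∩ W' = ∅ from (hd h h' hne).inter_eq, measure_empty])
      (fun W h => ((hSm W (hfin.mem_toFinset.1 h)).diff hBm).nullMeasurableSet)
      (fun W h => measure_ne_top_of_subset
        (sdiff_subset.trans ((hS W (hfin.mem_toFinset.1 h)).ge.trans
          (hPA W (hfin.mem_toFinset.1 h)))) hAt)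
    simp only [hfin.mem_toFinset] at h
    exact h
  have h1 : (⋃ W ∈ 𝒲, S W) \ B = ⋃ W ∈ 𝒲, S W \ B := by
    simp only [iUnion_sdiff]
  have h2 : volume.real (⋃ W ∈ 𝒲, S W) - volume.real B = t * (volume.real A - volume.real B) := by
    rw [← measureReal_sdiff hBX hBm (volume_ne_top_of_mem_JSets hX), h1, hSsum, ← hWsum, Finset.mul_sum]
    exact Finset.sum_congr rfl fun W h => hvol W (hfin.mem_toFinset.1 h)
  rw [targetMeasure]
  linarith

theorem isNestedAverage_nestedAvg [Nontrivial (EuclideanSpace ℝ (Fin n))]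
    (hq : IsCenterSelection q) (hA : A ∈ JSets n) (hB : B ∈ JSets n) (hBA : B ⊆ A) (hN : 1 ≤ N)
    (hε : 0 < ε) (ht : t ∈ Icc (0 : ℝ) 1) : IsNestedAverage t A B (nestedAvg q N ε t A B) := by
  unfold nestedAvg
  split_ifs with h
  · subst h
    exact ⟨hA, Subset.rfl, Subset.rfl, by rw [targetMeasure]; ring⟩
  · obtain ⟨𝒲, hfin, hne, hW, hd, hU, hP⟩ := exists_pieces_eq_image hA hB hBA h hε
    rw [hP, biUnion_image]
    refine isNestedAverage_biUnion hA hB hBA hfin hne hW hd hU fun W hW' => ?_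
    have h0 := volume_frontier_union_eq_zero hA hB hBA (hW W hW')
    refine isNestedAverage_simpleAvg hq (ci_mem_JSets ?_ h0) hB ?_ hN ht
    · exact hB.1.union (hA.1.subset ((hW W hW').subset.trans sdiff_subset))
    · exact hB.2.1.symm.subset.trans (ci_mono subset_union_left)

end NestedAverage

/-! ### Distances from the measure average to its arguments -/

section MeasureAverage

variable {n : ℕ} {q : Set (EuclideanSpace ℝ (Fin n)) → EuclideanSpace ℝ (Fin n)}
  {A B C S T : Set (EuclideanSpace ℝ (Fin n))} {N ε s t : ℝ}

theorem IsNestedAverage.volume_sdiff_left (h : IsNestedAverage t A B S) (hA : A ∈ JSets n)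
    (hB : B ∈ JSets n) (ht : t ≤ 1) : volume (A \ S) = ENNReal.ofReal (1 - t) * volume (A \ B) := by
  have hAt := volume_ne_top_of_mem_JSets hA
  rw [← ofReal_measureReal (measure_ne_top_of_subset sdiff_subset hAt),
    ← ofReal_measureReal (s := A \ B) (measure_ne_top_of_subset sdiff_subset hAt),
    ← ENNReal.ofReal_mul (sub_nonneg.2 ht),
    measureReal_sdiff h.ge (measurableSet_of_mem_JSets h.mem) hAt,
    measureReal_sdiff (h.le.trans h.ge) (measurableSet_of_mem_JSets hB) hAt, h.volume_real,
    targetMeasure]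
  congr 1
  ring

theorem IsNestedAverage.volume_sdiff_right (h : IsNestedAverage t A B S) (hA : A ∈ JSets n)
    (hB : B ∈ JSets n) (ht : 0 ≤ t) : volume (S \ B) = ENNReal.ofReal t * volume (A \ B) := by
  have hAt := volume_ne_top_of_mem_JSets hA
  have hSt := volume_ne_top_of_mem_JSets h.mem
  have hBm := measurableSet_of_mem_JSets hB
  rw [← ofReal_measureReal (measure_ne_top_of_subset sdiff_subset hSt),
    ← ofReal_measureReal (s := A \ B) (measure_ne_top_of_subset sdiff_subset hAt),
    ← ENNReal.ofReal_mul ht, measureReal_sdiff h.le hBm hSt,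
    measureReal_sdiff (h.le.trans h.ge) hBm hAt, h.volume_real, targetMeasure]
  congr 1
  ring

theorem volume_frontier_inter (hA : A ∈ JSets n) (hB : B ∈ JSets n) :
    volume (frontier (A ∩ B)) = 0 :=
  volume_frontier_inter_eq_zero hA.2.2 hB.2.2

theorem ci_inter_mem_JSets (hA : A ∈ JSets n) (hB : B ∈ JSets n) : ci (A ∩ B) ∈ JSets n :=
  ci_mem_JSets (hA.1.subset inter_subset_left) (volume_frontier_inter hA hB)

theorem ci_inter_subset_left (hA : A ∈ JSets n) : ci (A ∩ B) ⊆ A :=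
  (ci_mono inter_subset_left).trans hA.2.1.subset

theorem ci_inter_subset_right (hB : B ∈ JSets n) : ci (A ∩ B) ⊆ B :=
  (ci_mono inter_subset_right).trans hB.2.1.subset

theorem volume_sdiff_ci_inter (hA : A ∈ JSets n) (hB : B ∈ JSets n) :
    volume (A \ ci (A ∩ B)) = volume (A \ B) := by
  have h := measure_congr (ae_eq_set_sdiff (ae_eq_refl A) (ci_ae_eq (volume_frontier_inter hA hB)))
  exact h.trans (congrArg volume Set.sdiff_self_inter)

/-- The distance to `A` of the union of an average of `A` and `A ∩ B` with an average of `B` and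
`A ∩ B`. -/
theorem dMu_union_le (hA : A ∈ JSets n) (hB : B ∈ JSets n) (hs : 0 ≤ s) (hst : s + t = 1)
    (hS : IsNestedAverage t A (ci (A ∩ B)) S) (hT : IsNestedAverage s B (ci (A ∩ B)) T) :
    dMu (S ∪ T) A ≤ ENNReal.ofReal s * dMu A B := by
  have hC := ci_inter_mem_JSets hA hB
  -- As `S ⊆ A`, any excess over `A` comes from `T` and lies outside `ci (A ∩ B)`; any deficit
  -- already lies in `A \ S`. These have the proportion `s` of `A \ B` and `B \ A`.
  have hsub : symmDiff (S ∪ T) A ⊆ (A \ S) ∪ (T \ ci (A ∩ B)) := by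
    rintro x (⟨hx | hx, hxA⟩ | ⟨hx, hxS⟩)
    · exact absurd (hS.ge hx) hxA
    · exact Or.inr ⟨hx, fun h => hxA (ci_inter_subset_left hA h)⟩
    · exact Or.inl ⟨hx, fun h => hxS (Or.inl h)⟩
  have hBA : volume (B \ ci (A ∩ B)) = volume (B \ A) := by
    rw [inter_comm]
    exact volume_sdiff_ci_inter hB hA
  calc dMu (S ∪ T) A ≤ volume (A \ S) + volume (T \ ci (A ∩ B)) :=
        (measure_mono hsub).trans (measure_union_le _ _)
    _ = ENNReal.ofReal s * (volume (A \ B) + volume (B \ A)) := by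
        rw [hS.volume_sdiff_left hA hC (by linarith), hT.volume_sdiff_right hB hC hs,
          volume_sdiff_ci_inter hA hB, hBA, mul_add, show 1 - t = s by linarith]
    _ = ENNReal.ofReal s * dMu A B := by
        rw [dMu, measure_symmDiff_eq (measurableSet_of_mem_JSets hA).nullMeasurableSet
          (measurableSet_of_mem_JSets hB).nullMeasurableSet]

theorem dMu_comm (A B : Set (EuclideanSpace ℝ (Fin n))) : dMu A B = dMu B A := by
  rw [dMu, dMu, symmDiff_comm]

theorem dMu_triangle (A B C : Set (EuclideanSpace ℝ (Fin n))) : dMu A C ≤ dMu A B + dMu B C :=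
  measure_symmDiff_le A B C

variable [Nontrivial (EuclideanSpace ℝ (Fin n))]

theorem isNestedAverage_measureAvg_left (hq : IsCenterSelection q) (hA : A ∈ JSets n)
    (hB : B ∈ JSets n) (hN : 1 ≤ N) (hε : 0 < ε) (ht : t ∈ Icc (0 : ℝ) 1) :
    IsNestedAverage t A (ci (A ∩ B)) (nestedAvg q N ε t A (ci (A ∩ B))) :=
  isNestedAverage_nestedAvg hq hA (ci_inter_mem_JSets hA hB) (ci_inter_subset_left hA) hN hε ht

theorem isNestedAverage_measureAvg_right (hq : IsCenterSelection q) (hA : A ∈ JSets n)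
    (hB : B ∈ JSets n) (hN : 1 ≤ N) (hε : 0 < ε) (ht : t ∈ Icc (0 : ℝ) 1) :
    IsNestedAverage (1 - t) B (ci (A ∩ B)) (nestedAvg q N ε (1 - t) B (ci (A ∩ B))) :=
  isNestedAverage_nestedAvg hq hB (ci_inter_mem_JSets hA hB) (ci_inter_subset_right hB) hN hε
    ⟨by linarith [ht.2], by linarith [ht.1]⟩

theorem measureAvg_mem_JSets (hq : IsCenterSelection q) (hA : A ∈ JSets n)
    (hB : B ∈ JSets n) (hN : 1 ≤ N) (hε : 0 < ε) (ht : t ∈ Icc (0 : ℝ) 1) :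
    measureAvg q N ε t A B ∈ JSets n :=
  union_mem_JSets (isNestedAverage_measureAvg_left hq hA hB hN hε ht).mem
    (isNestedAverage_measureAvg_right hq hA hB hN hε ht).mem

theorem dMu_measureAvg_left (hq : IsCenterSelection q) (hA : A ∈ JSets n)
    (hB : B ∈ JSets n) (hN : 1 ≤ N) (hε : 0 < ε) (ht : t ∈ Icc (0 : ℝ) 1) :
    dMu (measureAvg q N ε t A B) A ≤ ENNReal.ofReal (1 - t) * dMu A B :=
  dMu_union_le hA hB (sub_nonneg.2 ht.2) (sub_add_cancel 1 t)
    (isNestedAverage_measureAvg_left hq hA hB hN hε ht)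
    (isNestedAverage_measureAvg_right hq hA hB hN hε ht)

theorem dMu_measureAvg_right (hq : IsCenterSelection q) (hA : A ∈ JSets n)
    (hB : B ∈ JSets n) (hN : 1 ≤ N) (hε : 0 < ε) (ht : t ∈ Icc (0 : ℝ) 1) :
    dMu (measureAvg q N ε t A B) B ≤ ENNReal.ofReal t * dMu A B := by
  have hS := isNestedAverage_measureAvg_left hq hA hB hN hε ht
  have hT := isNestedAverage_measureAvg_right hq hA hB hN hε ht
  rw [measureAvg, union_comm, dMu_comm A B]
  refine dMu_union_le hB hA ht.1 (add_sub_cancel t 1) (T := nestedAvg q N ε t A (ci (A ∩ B))) ?_ ?_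
  · rwa [inter_comm B A]
  · rwa [inter_comm B A]

end MeasureAverage

/-! ### Lane-Riesenfeld subdivision in a pseudometric space -/

section AbstractSubdivision

open ENNReal

/-- A binary average on `J` whose distances to its arguments are at most proportional to the
weights. -/
structure IsMetricAverage {α : Type*} [PseudoEMetricSpace α] (J : Set α) (avg : ℝ → α → α → α) :
    Prop where
  mem : ∀ A ∈ J, ∀ B ∈ J, ∀ t ∈ Icc (0 : ℝ) 1, avg t A B ∈ J
  edist_left : ∀ A ∈ J, ∀ B ∈ J, ∀ t ∈ Icc (0 : ℝ) 1,
    edist (avg t A B) A ≤ ENNReal.ofReal (1 - t) * edist A B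
  edist_right : ∀ A ∈ J, ∀ B ∈ J, ∀ t ∈ Icc (0 : ℝ) 1,
    edist (avg t A B) B ≤ ENNReal.ofReal t * edist A B

variable {α : Type*} [PseudoEMetricSpace α] {J : Set α} {avg : ℝ → α → α → α} {m : ℕ}
  {F : ℤ → α} {ℓ : ℝ≥0∞}

theorem half_mem_Icc : (1 / 2 : ℝ) ∈ Icc (0 : ℝ) 1 := by norm_num

theorem ofReal_half : ENNReal.ofReal (1 / 2) = 2⁻¹ := by
  rw [one_div, ENNReal.ofReal_inv_of_pos two_pos, ENNReal.ofReal_ofNat]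

theorem IsMetricAverage.half_left (h : IsMetricAverage J avg) {A B : α} (hA : A ∈ J) (hB : B ∈ J)
    (hAB : edist A B ≤ ℓ) : edist (avg (1 / 2) A B) A ≤ 2⁻¹ * ℓ := by
  have h1 := h.edist_left A hA B hB _ half_mem_Icc
  rw [show (1 - 1 / 2 : ℝ) = 1 / 2 by norm_num, ofReal_half] at h1
  exact h1.trans (by gcongr)

theorem IsMetricAverage.half_right (h : IsMetricAverage J avg) {A B : α} (hA : A ∈ J) (hB : B ∈ J)
    (hAB : edist A B ≤ ℓ) : edist (avg (1 / 2) A B) B ≤ 2⁻¹ * ℓ := by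
  have h1 := h.edist_right A hA B hB _ half_mem_Icc
  rw [ofReal_half] at h1
  exact h1.trans (by gcongr)

theorem half_add_half (ℓ : ℝ≥0∞) : 2⁻¹ * ℓ + 2⁻¹ * ℓ = ℓ := by
  rw [← add_mul, ENNReal.inv_two_add_inv_two, one_mul]

theorem half_mul_le (ℓ : ℝ≥0∞) : 2⁻¹ * ℓ ≤ ℓ := by
  conv_rhs => rw [← half_add_half ℓ]
  exact le_self_add

theorem edist_add_natCast_le (hl : ∀ i, edist (F i) (F (i + 1)) ≤ ℓ) (i : ℤ) (k : ℕ) :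
    edist (F i) (F (i + k)) ≤ k * ℓ := by
  induction k with
  | zero => simp
  | succ k ih =>
    have h := edist_triangle (F i) (F (i + k)) (F (i + (k + 1 : ℕ)))
    refine h.trans ?_
    push_cast
    rw [← add_assoc, add_mul, one_mul]
    exact add_le_add ih (hl _)

theorem edist_le_natAbs_mul (hl : ∀ i, edist (F i) (F (i + 1)) ≤ ℓ) (i j : ℤ) :
    edist (F i) (F j) ≤ (i - j).natAbs * ℓ := by
  rcases le_total i j with h | h
  · have h1 := edist_add_natCast_le hl i (i - j).natAbs
    rwa [show i + ((i - j).natAbs : ℤ) = j by omega] at h1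
  · have h1 := edist_add_natCast_le hl j (i - j).natAbs
    rwa [show j + ((i - j).natAbs : ℤ) = i by omega, edist_comm] at h1

theorem doubleStep_mem (h : IsMetricAverage J avg) (hF : ∀ i, F i ∈ J) (i : ℤ) :
    doubleStep avg F i ∈ J := by
  unfold doubleStep
  split_ifs
  · exact hF _
  · exact h.mem _ (hF _) _ (hF _) _ half_mem_Icc

theorem edist_doubleStep_succ (h : IsMetricAverage J avg) (hF : ∀ i, F i ∈ J)
    (hl : ∀ i, edist (F i) (F (i + 1)) ≤ ℓ) (i : ℤ) :
    edist (doubleStep avg F i) (doubleStep avg F (i + 1)) ≤ 2⁻¹ * ℓ := by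
  unfold doubleStep
  by_cases hi : Even i
  · have h1 : ¬ Even (i + 1) := by rw [Int.even_add_one]; exact not_not.2 hi
    have h2 : (i + 1) / 2 = i / 2 := by rw [Int.even_iff] at hi; omega
    rw [if_pos hi, if_neg h1, h2, edist_comm]
    exact h.half_left (hF _) (hF _) (hl _)
  · have h1 : Even (i + 1) := Int.even_add_one.2 hi
    have h2 : (i + 1) / 2 = i / 2 + 1 := by rw [Int.even_iff] at hi; omega
    rw [if_neg hi, if_pos h1, h2]
    exact h.half_right (hF _) (hF _) (hl _)

theorem edist_doubleStep_le (h : IsMetricAverage J avg) (hF : ∀ i, F i ∈ J)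
    (hl : ∀ i, edist (F i) (F (i + 1)) ≤ ℓ) (i : ℤ) :
    edist (doubleStep avg F i) (F (i / 2)) ≤ ℓ := by
  unfold doubleStep
  split_ifs
  · simp
  · exact (h.half_left (hF _) (hF _) (hl _)).trans (half_mul_le ℓ)

theorem averageStep_iterate (h : IsMetricAverage J avg) (hF : ∀ i, F i ∈ J)
    (hl : ∀ i, edist (F i) (F (i + 1)) ≤ ℓ) (j : ℕ) :
    (∀ i, (averageStep avg)^[j] F i ∈ J) ∧
    (∀ i, edist ((averageStep avg)^[j] F i) ((averageStep avg)^[j] F (i + 1)) ≤ ℓ) ∧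
    ∀ i, edist ((averageStep avg)^[j] F i) (F i) ≤ j * ℓ := by
  induction j with
  | zero => exact ⟨hF, hl, fun i => by simp⟩
  | succ j ih =>
    obtain ⟨ih1, ih2, ih3⟩ := ih
    simp only [Function.iterate_succ_apply']
    set G := (averageStep avg)^[j] F
    refine ⟨fun i => h.mem _ (ih1 _) _ (ih1 _) _ half_mem_Icc, fun i => ?_, fun i => ?_⟩
    · refine (edist_triangle _ (G (i + 1)) _).trans ?_
      conv_rhs => rw [← half_add_half ℓ]
      refine add_le_add (h.half_right (ih1 _) (ih1 _) (ih2 _)) ?_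
      rw [edist_comm]
      exact h.half_left (ih1 _) (ih1 _) (ih2 _)
    · refine (edist_triangle _ (G i) _).trans ?_
      push_cast
      rw [add_mul, one_mul, add_comm]
      exact add_le_add (ih3 i) ((h.half_left (ih1 _) (ih1 _) (ih2 _)).trans (half_mul_le ℓ))

/-- The constant bounding the displacement in one refinement step. -/
def refineConst (m : ℕ) : ℕ := (m - 1) + (m - 1) / 2 + 1

theorem refine_mem (h : IsMetricAverage J avg) (hF : ∀ i, F i ∈ J)
    (hl : ∀ i, edist (F i) (F (i + 1)) ≤ ℓ) (i : ℤ) : refine avg m F i ∈ J :=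
  (averageStep_iterate h (doubleStep_mem h hF) (edist_doubleStep_succ h hF hl) _).1 _

theorem edist_refine_succ (h : IsMetricAverage J avg) (hF : ∀ i, F i ∈ J)
    (hl : ∀ i, edist (F i) (F (i + 1)) ≤ ℓ) (i : ℤ) :
    edist (refine avg m F i) (refine avg m F (i + 1)) ≤ 2⁻¹ * ℓ := by
  have := (averageStep_iterate h (doubleStep_mem h hF) (edist_doubleStep_succ h hF hl) (m - 1)).2.1
    (i - ((m - 1) / 2 : ℕ))
  rwa [sub_add_eq_add_sub] at this

/-- Three displacements add up: `m - 1` averaging steps, the index shift by `(m - 1) / 2`, and the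
doubling step. -/
theorem edist_refine_le (h : IsMetricAverage J avg) (hF : ∀ i, F i ∈ J)
    (hl : ∀ i, edist (F i) (F (i + 1)) ≤ ℓ) (i : ℤ) :
    edist (refine avg m F i) (F (i / 2)) ≤ refineConst m * ℓ := by
  have hs := edist_doubleStep_succ h hF hl
  set c := (m - 1) / 2 with hc
  have h1 := (averageStep_iterate h (doubleStep_mem h hF) hs (m - 1)).2.2 (i - (c : ℕ))
  have h2 := edist_add_natCast_le hs (i - (c : ℕ)) c
  rw [sub_add_cancel] at h2
  have h3 := edist_doubleStep_le h hF hl i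
  calc edist (refine avg m F i) (F (i / 2))
      ≤ ((m - 1 : ℕ) * (2⁻¹ * ℓ) + c * (2⁻¹ * ℓ)) + ℓ :=
        (edist_triangle4 _ _ _ _).trans (add_le_add (add_le_add h1 h2) h3)
    _ ≤ ((m - 1 : ℕ) * ℓ + c * ℓ) + ℓ := by gcongr <;> exact half_mul_le ℓ
    _ = refineConst m * ℓ := by rw [refineConst, ← hc]; push_cast; ring

omit [PseudoEMetricSpace α] in
theorem level_succ (k : ℕ) : level avg m F (k + 1) = refine avg m (level avg m F k) :=
  Function.iterate_succ_apply' _ _ _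

theorem level_mem_and_edist_succ (h : IsMetricAverage J avg) (hF : ∀ i, F i ∈ J)
    (hl : ∀ i, edist (F i) (F (i + 1)) ≤ ℓ) (k : ℕ) :
    (∀ i, level avg m F k i ∈ J) ∧
    ∀ i, edist (level avg m F k i) (level avg m F k (i + 1)) ≤ 2⁻¹ ^ k * ℓ := by
  induction k with
  | zero => simpa [level] using ⟨hF, hl⟩
  | succ k ih =>
    rw [level_succ]
    refine ⟨refine_mem h ih.1 ih.2, fun i => ?_⟩
    rw [pow_succ', mul_assoc]
    exact edist_refine_succ h ih.1 ih.2 i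

theorem weight_mem_Icc (y : ℝ) : (⌊y⌋ : ℝ) + 1 - y ∈ Icc (0 : ℝ) 1 :=
  ⟨by linarith [Int.lt_floor_add_one y], by linarith [Int.floor_le y]⟩

theorem interpolant_mem (h : IsMetricAverage J avg) (hF : ∀ i, F i ∈ J)
    (hl : ∀ i, edist (F i) (F (i + 1)) ≤ ℓ) (k : ℕ) (x : ℝ) : interpolant avg m F k x ∈ J :=
  have H := level_mem_and_edist_succ h hF hl k
  h.mem _ (H.1 _) _ (H.1 _) _ (weight_mem_Icc _)

theorem edist_interpolant_level (h : IsMetricAverage J avg) (hF : ∀ i, F i ∈ J)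
    (hl : ∀ i, edist (F i) (F (i + 1)) ≤ ℓ) (k : ℕ) (x : ℝ) :
    edist (interpolant avg m F k x) (level avg m F k ⌊x * 2 ^ k⌋) ≤ 2⁻¹ ^ k * ℓ := by
  have H := level_mem_and_edist_succ (m := m) h hF hl k
  have hw := weight_mem_Icc (x * 2 ^ k)
  refine (h.edist_left _ (H.1 _) _ (H.1 _) _ hw).trans ?_
  calc _ ≤ 1 * (2⁻¹ ^ k * ℓ) := by
        gcongr
        · exact ENNReal.ofReal_le_one.2 (by linarith [hw.1])
        · exact H.2 _
    _ = _ := one_mul _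

theorem edist_interpolant_succ (h : IsMetricAverage J avg) (hF : ∀ i, F i ∈ J)
    (hl : ∀ i, edist (F i) (F (i + 1)) ≤ ℓ) (k : ℕ) (x : ℝ) :
    edist (interpolant avg m F k x) (interpolant avg m F (k + 1) x) ≤
      (refineConst m + 2) * ℓ * 2⁻¹ ^ k := by
  have H := level_mem_and_edist_succ (m := m) h hF hl k
  have h1 := edist_interpolant_level (m := m) h hF hl k x
  have h2 := edist_interpolant_level (m := m) h hF hl (k + 1) x
  have h3 := edist_refine_le (m := m) h H.1 H.2 ⌊x * 2 ^ (k + 1)⌋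
  -- The parent of the level `k + 1` cell containing `x` is its level `k` cell, so the refinement
  -- bound compares the two interpolants at the same `x`.
  have hfl : ⌊x * 2 ^ (k + 1)⌋ / 2 = ⌊x * 2 ^ k⌋ := by
    have := Int.mul_cast_floor_div_cancel_of_pos (n := 2) two_pos (x * 2 ^ k)
    rwa [Int.cast_ofNat, mul_assoc, ← pow_succ] at this
  rw [hfl, ← level_succ, edist_comm] at h3
  rw [edist_comm] at h2
  have h2' : 2⁻¹ ^ (k + 1) * ℓ ≤ 2⁻¹ ^ k * ℓ := by
    rw [pow_succ', mul_assoc]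
    exact half_mul_le _
  calc _ ≤ 2⁻¹ ^ k * ℓ + refineConst m * (2⁻¹ ^ k * ℓ) + 2⁻¹ ^ k * ℓ :=
        (edist_triangle4 _ _ _ _).trans (add_le_add (add_le_add h1 h3) (h2.trans h2'))
    _ = _ := by ring

theorem natAbs_floor_sub_floor_le (x y : ℝ) :
    ((⌊x⌋ - ⌊y⌋).natAbs : ℝ) ≤ |x - y| + 1 := by
  rw [Nat.cast_natAbs, Int.cast_abs, Int.cast_sub]
  have h1 := Int.floor_le x
  have h2 := Int.lt_floor_add_one x
  have h3 := Int.floor_le y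
  have h4 := Int.lt_floor_add_one y
  have h5 := le_abs_self (x - y)
  have h6 := neg_abs_le (x - y)
  rw [abs_le]
  constructor <;> linarith

/-- The two cells are at most `2^k|x-y| + 1` indices apart, with gaps at most `2⁻ᵏℓ`. The extra
index and the two passages from interpolant to cell give the 3. -/
theorem edist_interpolant_le (h : IsMetricAverage J avg) (hF : ∀ i, F i ∈ J)
    (hl : ∀ i, edist (F i) (F (i + 1)) ≤ ℓ) (k : ℕ) (x y : ℝ) :
    edist (interpolant avg m F k x) (interpolant avg m F k y) ≤
      ℓ * ENNReal.ofReal |x - y| + 3 * ℓ * 2⁻¹ ^ k := by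
  have H := level_mem_and_edist_succ (m := m) h hF hl k
  have h1 := edist_interpolant_level (m := m) h hF hl k x
  have h2 := edist_le_natAbs_mul H.2 ⌊x * 2 ^ k⌋ ⌊y * 2 ^ k⌋
  have h3 := edist_interpolant_level (m := m) h hF hl k y
  rw [edist_comm] at h3
  have h4 : ((⌊x * 2 ^ k⌋ - ⌊y * 2 ^ k⌋).natAbs : ℝ≥0∞) ≤ ENNReal.ofReal |x - y| * 2 ^ k + 1 := by
    have h5 := natAbs_floor_sub_floor_le (x * 2 ^ k) (y * 2 ^ k)
    rw [← sub_mul, abs_mul, abs_of_pos (by positivity : (0 : ℝ) < 2 ^ k)] at h5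
    have h6 := ENNReal.ofReal_le_ofReal h5
    rwa [ENNReal.ofReal_natCast, ENNReal.ofReal_add (by positivity) zero_le_one,
      ENNReal.ofReal_mul (abs_nonneg _), ENNReal.ofReal_pow two_pos.le, ENNReal.ofReal_ofNat,
      ENNReal.ofReal_one] at h6
  have h5 : (2 : ℝ≥0∞) ^ k * 2⁻¹ ^ k = 1 := by
    rw [← mul_pow, ENNReal.mul_inv_cancel two_ne_zero ofNat_ne_top, one_pow]
  calc _ ≤ 2⁻¹ ^ k * ℓ + (ENNReal.ofReal |x - y| * 2 ^ k + 1) * (2⁻¹ ^ k * ℓ) + 2⁻¹ ^ k * ℓ :=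
        (edist_triangle4 _ _ _ _).trans
          (add_le_add (add_le_add h1 (h2.trans (by gcongr))) h3)
    _ = ℓ * ENNReal.ofReal |x - y| * (2 ^ k * 2⁻¹ ^ k) + 3 * ℓ * 2⁻¹ ^ k := by ring
    _ = _ := by rw [h5, mul_one]

end AbstractSubdivision

/-! ### The limit set and the convergence theorem -/

section Limit

open ENNReal Filter Topology

variable {n : ℕ}

/-- The symmetric difference in measure as a pseudometric. -/
noncomputable abbrev dMuPseudoEMetricSpace (n : ℕ) :
    PseudoEMetricSpace (Set (EuclideanSpace ℝ (Fin n))) where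
  edist := dMu
  edist_self A := by simp [dMu]
  edist_comm := dMu_comm
  edist_triangle := dMu_triangle

/-- The set of points that belong to infinitely many of the sets `S k` is their limit when
consecutive distances decrease geometrically. -/
theorem dMu_limsup_le {S : ℕ → Set (EuclideanSpace ℝ (Fin n))} {c : ℝ≥0∞}
    (h : ∀ k, dMu (S k) (S (k + 1)) ≤ c * 2⁻¹ ^ k) (k : ℕ) :
    dMu (S k) (⋂ i, ⋃ j ≥ i, S j) ≤ 2 * c * 2⁻¹ ^ k := by
  -- If membership of `p` never changes from level `k` on, then `p` is in the upper limit exactly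
  -- when it is in `S k`.
  have hsub : symmDiff (S k) (⋂ i, ⋃ j ≥ i, S j) ⊆
      ⋃ j, symmDiff (S (k + j)) (S (k + j + 1)) := by
    intro p hp
    by_contra hcon
    simp only [mem_iUnion, not_exists, mem_symmDiff] at hcon
    have hiff : ∀ j, p ∈ S (k + j) ↔ p ∈ S k := by
      intro j
      induction j with
      | zero => rfl
      | succ j ih => rw [← ih, ← add_assoc]; have := hcon j; tauto
    have hlim : p ∈ (⋂ i, ⋃ j ≥ i, S j) ↔ p ∈ S k := by
      simp only [mem_iInter, mem_iUnion]
      constructor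
      · intro H
        obtain ⟨j, hj, hpj⟩ := H k
        rw [← hiff (j - k)]
        rwa [Nat.add_sub_cancel' hj]
      · exact fun H i => ⟨k + i, Nat.le_add_left i k, (hiff i).2 H⟩
    rw [mem_symmDiff] at hp
    tauto
  calc dMu (S k) (⋂ i, ⋃ j ≥ i, S j) ≤ ∑' j, dMu (S (k + j)) (S (k + j + 1)) :=
        (measure_mono hsub).trans (measure_iUnion_le _)
    _ ≤ ∑' j, c * 2⁻¹ ^ k * 2⁻¹ ^ j := by
        refine ENNReal.tsum_le_tsum fun j => (h (k + j)).trans (le_of_eq ?_)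
        rw [pow_add, mul_assoc]
    _ = 2 * c * 2⁻¹ ^ k := by
        rw [ENNReal.tsum_mul_left, ENNReal.tsum_geometric, ENNReal.one_sub_inv_two, inv_inv]
        ring

theorem tendsto_const_mul_inv_two_pow {c : ℝ≥0∞} (hc : c ≠ ⊤) :
    Tendsto (fun k : ℕ => c * 2⁻¹ ^ k) atTop (𝓝 0) := by
  have h := ENNReal.Tendsto.const_mul (a := c)
    (ENNReal.tendsto_pow_atTop_nhds_zero_of_lt_one (ENNReal.inv_lt_one.2 one_lt_two)) (Or.inr hc)
  rwa [mul_zero] at h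

end Limit

theorem theorem5p1 (n : ℕ) (hn : 1 ≤ n)
    (q : Set (EuclideanSpace ℝ (Fin n)) → EuclideanSpace ℝ (Fin n)) (hq : IsCenterSelection q)
    (N : ℝ) (hN : 1 ≤ N) (ε : ℝ) (hε : 0 < ε)
    (m : ℕ) (hm : 1 ≤ m)
    (F : ℤ → Set (EuclideanSpace ℝ (Fin n))) (hF : ∀ i, F i ∈ JSets n)
    (hL : (⨆ i : ℤ, dMu (F i) (F (i + 1))) ≠ ⊤) :
    (∀ (k : ℕ) (x : ℝ), interpolant (measureAvg q N ε) m F k x ∈ JSets n) ∧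
    ∃ Finf : ℝ → Set (EuclideanSpace ℝ (Fin n)),
      (∀ x, Finf x ∈ LSets n) ∧
      (∀ δ : ENNReal, 0 < δ → ∃ K : ℕ, ∀ k ≥ K, ∀ x : ℝ,
        dMu (interpolant (measureAvg q N ε) m F k x) (Finf x) < δ) ∧
      (∀ x y : ℝ, dMu (Finf x) (Finf y) ≤
        (⨆ i : ℤ, dMu (F i) (F (i + 1))) * ENNReal.ofReal |x - y|) := by
  -- In dimension zero the whole space is bounded and its frontier is empty, so `n ≥ 1` is essential
  -- to the signed-distance arguments.
  have : NeZero n := ⟨by omega⟩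
  have : Nontrivial (EuclideanSpace ℝ (Fin n)) := inferInstance
  let _ : PseudoEMetricSpace (Set (EuclideanSpace ℝ (Fin n))) := dMuPseudoEMetricSpace n
  have hav : IsMetricAverage (JSets n) (measureAvg q N ε) :=
    ⟨fun A hA B hB t ht => measureAvg_mem_JSets hq hA hB hN hε ht,
      fun A hA B hB t ht => dMu_measureAvg_left hq hA hB hN hε ht,
      fun A hA B hB t ht => dMu_measureAvg_right hq hA hB hN hε ht⟩
  set L := ⨆ i : ℤ, dMu (F i) (F (i + 1))
  have hl : ∀ i, edist (F i) (F (i + 1)) ≤ L := fun i => le_iSup (fun i => dMu (F i) (F (i + 1))) i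
  set G := interpolant (measureAvg q N ε) m F
  have hG : ∀ k x, G k x ∈ JSets n := interpolant_mem hav hF hl
  refine ⟨hG, fun x => ⋂ i, ⋃ j ≥ i, G j x, ?_⟩
  set c : ENNReal := (refineConst m + 2) * L
  have hc : 2 * c ≠ ⊤ := ENNReal.mul_ne_top ENNReal.ofNat_ne_top
    (ENNReal.mul_ne_top (by finiteness) hL)
  have hlim : ∀ k x, dMu (G k x) (⋂ i, ⋃ j ≥ i, G j x) ≤ 2 * c * 2⁻¹ ^ k := fun k x =>
    dMu_limsup_le (fun k => edist_interpolant_succ hav hF hl k x) k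
  refine ⟨fun x => ⟨?_, ?_⟩, fun δ hδ => ?_, fun x y => ?_⟩
  · exact (MeasurableSet.iInter fun i => MeasurableSet.iUnion fun j => MeasurableSet.iUnion
      fun _ => measurableSet_of_mem_JSets (hG j x)).nullMeasurableSet
  · have h1 := hlim 0 x
    have h2 : (⋂ i, ⋃ j ≥ i, G j x) ⊆ G 0 x ∪ symmDiff (G 0 x) (⋂ i, ⋃ j ≥ i, G j x) := by
      intro p hp
      by_cases h : p ∈ G 0 x
      · exact Or.inl h
      · exact Or.inr (Or.inr ⟨hp, h⟩)
    rw [pow_zero, mul_one] at h1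
    exact measure_ne_top_of_subset h2 (measure_union_ne_top
      (volume_ne_top_of_mem_JSets (hG 0 x)) (ne_top_of_le_ne_top hc h1))
  · obtain ⟨K, hK⟩ := Filter.eventually_atTop.1
      ((tendsto_const_mul_inv_two_pow hc).eventually_lt_const hδ)
    exact ⟨K, fun k hk x => (hlim k x).trans_lt (hK k hk)⟩
  · have hd : (2 * c + 3 * L + 2 * c) ≠ ⊤ := by
      have : 3 * L ≠ ⊤ := ENNReal.mul_ne_top ENNReal.ofNat_ne_top hL
      finiteness
    have ht := (tendsto_const_mul_inv_two_pow hd).const_add (L * ENNReal.ofReal |x - y|)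
    rw [add_zero] at ht
    -- Compare through the level `k` interpolants; all error terms are finite multiples of `2⁻ᵏ`, so
    -- exactly `L|x-y|` survives.
    refine ge_of_tendsto' ht fun k => ?_
    have h1 := hlim k x
    have h2 := edist_interpolant_le (m := m) hav hF hl k x y
    have h3 := hlim k y
    rw [dMu_comm] at h1
    calc dMu (⋂ i, ⋃ j ≥ i, G j x) (⋂ i, ⋃ j ≥ i, G j y)
        ≤ 2 * c * 2⁻¹ ^ k + (L * ENNReal.ofReal |x - y| + 3 * L * 2⁻¹ ^ k) + 2 * c * 2⁻¹ ^ k :=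
          (dMu_triangle _ (G k y) _).trans
            (add_le_add ((dMu_triangle _ (G k x) _).trans (add_le_add h1 h2)) h3)
      _ = _ := by ring
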